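/- A hypergraph $H=(X,E)$ consists of a finite vertex set $X$ and a finite non-empty collection $E$ of subsets of $X$ (hyperedges). A set $C\subseteq X$ induces an equivalence relation on $E$, in which $e\sim f$ if and only if $e\cap C=f\cap C$; $C$ is shattered if it induces all $2^{|C|}$ possible equivalence classes, and the VC dimension of $H$ is the maximum size of a shattered set. $H$ is twin-free if no two hyperedges are equal and no two vertices belong to exactly the same hyperedges. Max Partial VC Dimension: given $H=(X,E)$ and an integer $0\le k\le |X|$, find a set $C\subseteq X$ with $|C|=k$ that maximizes the number of equivalence classes induced by $C$. A 2-approximation algorithm for it always returns a set $C$ with $|C|=k$ that induces at least half of the maximum number of classes. Max VC Dimension: given $H$, find a shattered set of maximum size. A randomized 2-approximation algorithm for it always returns a shattered set $Y$, and for every $H$, with probability at least $2/3$ over its coin tosses, $2|Y|$ is at least the VC dimension of $H$. Running times are worst-case numbers of steps, as functions of the size of the encoded input, of programs over binary trees (cons cells) with unit-cost instructions, while loops, coin tosses and subroutines; hypergraphs are encoded by incidence matrices and integers in unary. **Theorem.** Any 2-approximation algorithm for Max Partial VC Dimension can be transformed into a randomized 2-approximation algorithm for Max VC Dimension with polynomial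 overhead in the running time. Precisely, there is a polynomial $p$ such that for every non-decreasing $T:\mathbb N\to\mathbb N$ and every 2-approximation algorithm $\mathscr A$ for Max Partial VC Dimension (required to work only on twin-free hypergraphs) with running time at most $T(N)$ on inputs of size $N$, there is a randomized 2-approximation algorithm for Max VC Dimension (on all hypergraphs) with running time at most $p(N)\cdot\bigl(T(p(N))+1\bigr)$ on inputs of size $N$. -/

import Mathlib

namespace PartialVC

/-! ### Machine model

Structured programs with `while` loops over binary trees ("Lisp cells"), with fair coin tosses and
non-recursive subroutines.  Every elementary instruction, every test and every subroutine call costs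
one step and creates at most one new cell, so running times in this model and on (probabilistic)
Turing machines or random access machines agree up to a polynomial. -/

/-- The data on which programs operate: finite binary trees. -/
inductive Data : Type
  | nil : Data
  | cons : Data → Data → Data

/-- The number of nodes of a tree. -/
def Data.size : Data → ℕ
  | .nil => 1
  | .cons a b => a.size + b.size + 1

/-- Programs.  Variables are named by natural numbers. -/
inductive Cmd : Type
  /-- `x := nil` -/
  | setNil (x : ℕ) : Cmd
  /-- `x := y` -/
  | copy (x y : ℕ) : Cmd
  /-- `x := cons y z` -/
  | cons (x y z : ℕ) : Cmd
  /-- `x := first component of y` -/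
  | head (x y : ℕ) : Cmd
  /-- `x := second component of y` -/
  | tail (x y : ℕ) : Cmd
  /-- `x := a fresh fair random bit` -/
  | flip (x : ℕ) : Cmd
  /-- first `c`, then `d` -/
  | seq (c d : Cmd) : Cmd
  /-- if `x` is not `nil` then `c` else `d` -/
  | ite (x : ℕ) (c d : Cmd) : Cmd
  /-- while `x` is not `nil` do `c` -/
  | while (x : ℕ) (c : Cmd) : Cmd
  /-- `x := result of the subroutine c on input y`; the subroutine has its own variables -/
  | call (x : ℕ) (c : Cmd) (y : ℕ) : Cmd

/-- An assignment of values to the variables. -/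
abbrev Store := ℕ → Data

/-- An infinite sequence of coin tosses. -/
abbrev Coins := ℕ → Bool

/-- First component (`nil` for `nil`). -/
def Data.fst : Data → Data
  | .nil => .nil
  | .cons a _ => a

/-- Second component (`nil` for `nil`). -/
def Data.snd : Data → Data
  | .nil => .nil
  | .cons _ b => b

/-- Truth values as trees. -/
def encBool : Bool → Data
  | false => .nil
  | true => .cons .nil .nil

/-- The initial store on input `d`: variable `0` holds the input, all others hold `nil`. -/
def initStore (d : Data) : Store := Function.update (fun _ => Data.nil) 0 d

/-- `Exec c s ω s' ω' t`: started in store `s` with the coin tosses `ω` still to come, the program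
`c` halts after exactly `t` steps in store `s'`, with the coin tosses `ω'` still unused. -/
inductive Exec : Cmd → Store → Coins → Store → Coins → ℕ → Prop
  | setNil (x : ℕ) (s : Store) (ω : Coins) :
      Exec (.setNil x) s ω (Function.update s x .nil) ω 1
  | copy (x y : ℕ) (s : Store) (ω : Coins) :
      Exec (.copy x y) s ω (Function.update s x (s y)) ω 1
  | cons (x y z : ℕ) (s : Store) (ω : Coins) :
      Exec (.cons x y z) s ω (Function.update s x (.cons (s y) (s z))) ω 1
  | head (x y : ℕ) (s : Store) (ω : Coins) :
      Exec (.head x y) s ω (Function.update s x (s y).fst) ω 1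
  | tail (x y : ℕ) (s : Store) (ω : Coins) :
      Exec (.tail x y) s ω (Function.update s x (s y).snd) ω 1
  | flip (x : ℕ) (s : Store) (ω : Coins) :
      Exec (.flip x) s ω (Function.update s x (encBool (ω 0))) (fun i => ω (i + 1)) 1
  | seq {c d : Cmd} {s s' s'' : Store} {ω ω' ω'' : Coins} {t u : ℕ} :
      Exec c s ω s' ω' t → Exec d s' ω' s'' ω'' u → Exec (.seq c d) s ω s'' ω'' (t + u)
  | iteThen {x : ℕ} {c d : Cmd} {s s' : Store} {ω ω' : Coins} {t : ℕ} :
      s x ≠ .nil → Exec c s ω s' ω' t → Exec (.ite x c d) s ω s' ω' (t + 1)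
  | iteElse {x : ℕ} {c d : Cmd} {s s' : Store} {ω ω' : Coins} {t : ℕ} :
      s x = .nil → Exec d s ω s' ω' t → Exec (.ite x c d) s ω s' ω' (t + 1)
  | whileDone {x : ℕ} {c : Cmd} {s : Store} {ω : Coins} :
      s x = .nil → Exec (.while x c) s ω s ω 1
  | whileStep {x : ℕ} {c : Cmd} {s s' s'' : Store} {ω ω' ω'' : Coins} {t u : ℕ} :
      s x ≠ .nil → Exec c s ω s' ω' t → Exec (.while x c) s' ω' s'' ω'' u →
      Exec (.while x c) s ω s'' ω'' (t + u + 1)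
  | call {x y : ℕ} {c : Cmd} {s s' : Store} {ω ω' : Coins} {t : ℕ} :
      Exec c (initStore (s y)) ω s' ω' t →
      Exec (.call x c y) s ω (Function.update s x (s' 0)) ω' (t + 1)

/-- On input `d` and with coin tosses `ω`, the program `P` halts after exactly `t` steps with
output `out` (the final value of variable `0`). -/
def Outputs (P : Cmd) (d : Data) (ω : Coins) (out : Data) (t : ℕ) : Prop :=
  ∃ s' ω', Exec P (initStore d) ω s' ω' t ∧ s' 0 = out

/-- The law of an infinite sequence of independent fair coin tosses. -/
noncomputable def fairCoins : MeasureTheory.Measure Coins :=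
  MeasureTheory.Measure.infinitePi fun _ : ℕ => (PMF.uniformOfFintype Bool).toMeasure

/-! ### Hypergraphs -/

/-- A finite hypergraph with vertex set `{0, …, n - 1}`, given by the list of its hyperedges, of
which there is at least one. -/
structure Hypergraph where
  /-- number of vertices -/
  n : ℕ
  /-- the hyperedges, in some order -/
  edges : List (Finset (Fin n))
  edges_ne_nil : edges ≠ []

/-- No two hyperedges are equal, and no two vertices belong to the same hyperedges. -/
def Hypergraph.TwinFree (H : Hypergraph) : Prop :=
  H.edges.Nodup ∧ ∀ x y : Fin H.n, (∀ e ∈ H.edges, x ∈ e ↔ y ∈ e) → x = y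

/-- The number of neighbourhood equivalence classes induced by `C`, where two hyperedges are
equivalent if they have the same intersection with `C`. -/
def Hypergraph.numClasses (H : Hypergraph) (C : Finset (Fin H.n)) : ℕ :=
  (H.edges.map fun e => e ∩ C).toFinset.card

/-- `C` induces all `2 ^ |C|` possible classes. -/
def Hypergraph.Shattered (H : Hypergraph) (C : Finset (Fin H.n)) : Prop :=
  H.edges.toFinset.Shatters C

/-- The maximum size of a shattered set. -/
def Hypergraph.vcDim (H : Hypergraph) : ℕ := H.edges.toFinset.vcDim

/-! ### Encodings -/

/-- Lists as right-nested trees. -/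
def encList {α : Type*} (enc : α → Data) : List α → Data
  | [] => .nil
  | a :: l => .cons (enc a) (encList enc l)

/-- Natural numbers in unary (all numbers occurring below are at most the number of vertices). -/
def encNat (k : ℕ) : Data := encList encBool (List.replicate k false)

/-- A set of vertices as its characteristic vector of `n` bits. -/
def encSet {n : ℕ} (C : Finset (Fin n)) : Data :=
  encList encBool (List.ofFn fun i : Fin n => decide (i ∈ C))

/-- A hypergraph as its number of vertices together with its incidence matrix. -/
def Hypergraph.encode (H : Hypergraph) : Data :=
  .cons (encNat H.n) (encList encSet H.edges)

/-- An instance `(H, k)` of Max Partial VC Dimension. -/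
def encInstance (H : Hypergraph) (k : ℕ) : Data := .cons (encNat k) H.encode

/-! ### Approximation algorithms -/

/-- `A` is a 2-approximation algorithm for Max Partial VC Dimension on twin-free hypergraphs with
running time at most `T` (as a function of the size of the encoded instance): given `H` and
`k ≤ |X|`, it outputs a set of exactly `k` vertices that induces at least half the maximum number of
classes.  No chance of failure is allowed: this has to hold whatever the coin tosses, if the program
uses any. -/
def IsTwoApproxMaxPartialVC (A : Cmd) (T : ℕ → ℕ) : Prop :=
  ∀ (H : Hypergraph) (k : ℕ), H.TwinFree → k ≤ H.n → ∀ ω : Coins,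
    ∃ (C : Finset (Fin H.n)) (t : ℕ),
      Outputs A (encInstance H k) ω (encSet C) t ∧ t ≤ T (encInstance H k).size ∧
      C.card = k ∧ ∀ D : Finset (Fin H.n), D.card = k → H.numClasses D ≤ 2 * H.numClasses C

/-- `B` is a randomized 2-approximation algorithm for Max VC Dimension with running time at most
`T`: for every hypergraph `H` and all coin tosses it outputs a shattered set within `T` steps, and
with probability at least `2/3` the size of that set is at least half the VC dimension of `H`. -/
def IsRandomizedTwoApproxMaxVC (B : Cmd) (T : ℕ → ℕ) : Prop :=
  ∀ H : Hypergraph,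
    (∀ ω : Coins, ∃ (Y : Finset (Fin H.n)) (t : ℕ),
      Outputs B H.encode ω (encSet Y) t ∧ t ≤ T H.encode.size ∧ H.Shattered Y) ∧
    2 / 3 ≤ fairCoins {ω | ∃ (Y : Finset (Fin H.n)) (t : ℕ),
      Outputs B H.encode ω (encSet Y) t ∧ H.Shattered Y ∧ H.vcDim ≤ 2 * Y.card}

end PartialVC

namespace PartialVC

/-! Let d be the VC dimension of H. The square of H has two disjoint copies of the vertex set as its
vertices and the unions of a hyperedge of the first copy with one of the second as its hyperedges.
Two copies of a shattered set are shattered in the square, and a shattered set of the square meets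
each copy in a set shattered by H. Deleting twins harms neither fact, since a shattered set never
contains two equal columns.

On the reduced square with k = 2d, the given algorithm returns a set C of size 2d inducing at least
half of 2^(2d) classes. Down-compression of the traces on C keeps their number and produces a family
closed under subsets, all of whose members are shattered by the original traces
(`shatters_of_mem_iterCompress`). Fewer than half of the subsets of C have size below d
(`two_mul_card_filter_card_lt`), so some member has size at least d. The larger of its parts in the
two copies is a shattered set of H of size at least d / 2 (`exists_mem_candidates`).

Squaring is what handles odd d: exactly half of the subsets of a d-set then have size at most (d -
1) / 2, so the same argument on H itself would miss the factor 2. Since d is unknown, every k is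
tried and the largest candidate kept; candidates are shattered whatever C is (`improve_bits`,
`exec_mainLoop`). The reduction tosses no coins of its own and succeeds for every outcome of the
coins.

For the running time, `PolyTime` is shown to be closed under composition, branching and
size-controlled folds, and the processing before and after each call to the algorithm is assembled
from these operations. -/

open Polynomial

/-! ### Polynomially bounded functions -/

/-- Types whose elements are represented by trees. -/
class Enc (α : Type) where
  /-- the representation -/
  enc : α → Data

instance : Enc Bool := ⟨encBool⟩
instance : Enc ℕ := ⟨encNat⟩
instance {α : Type} [Enc α] : Enc (List α) := ⟨encList Enc.enc⟩
instance {α β : Type} [Enc α] [Enc β] : Enc (α × β) := ⟨fun p => .cons (Enc.enc p.1) (Enc.enc p.2)⟩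

/-- The size of the representation of `a`. -/
def esize {α : Type} [Enc α] (a : α) : ℕ := (Enc.enc a).size

variable {α β γ σ : Type} [Enc α] [Enc β] [Enc γ] [Enc σ]

theorem eval_nat_mono (p : ℕ[X]) : Monotone fun n => p.eval n := by
  intro a b h
  induction p using Polynomial.induction_on' with
  | add p q hp hq => simpa using Nat.add_le_add hp hq
  | monomial n c => simpa using Nat.mul_le_mul_left c (Nat.pow_le_pow_left h n)

/-- `f` is bounded by a polynomial in the size of its argument. -/
def PolyBdd (f : γ → ℕ) : Prop := ∃ p : ℕ[X], ∀ c, f c ≤ p.eval (esize c)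

namespace PolyBdd

theorem mono {f g : γ → ℕ} (hg : PolyBdd g) (h : ∀ c, f c ≤ g c) : PolyBdd f :=
  let ⟨p, hp⟩ := hg
  ⟨p, fun c => (h c).trans (hp c)⟩

theorem const (n : ℕ) : PolyBdd fun _ : γ => n := ⟨C n, fun c => by simp⟩

theorem size : PolyBdd fun c : γ => esize c := ⟨X, fun c => by simp⟩

theorem add {f g : γ → ℕ} (hf : PolyBdd f) (hg : PolyBdd g) : PolyBdd fun c => f c + g c := by
  obtain ⟨p, hp⟩ := hf
  obtain ⟨q, hq⟩ := hg
  exact ⟨p + q, fun c => by simpa using Nat.add_le_add (hp c) (hq c)⟩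

theorem mul {f g : γ → ℕ} (hf : PolyBdd f) (hg : PolyBdd g) : PolyBdd fun c => f c * g c := by
  obtain ⟨p, hp⟩ := hf
  obtain ⟨q, hq⟩ := hg
  exact ⟨p * q, fun c => by simpa using Nat.mul_le_mul (hp c) (hq c)⟩

theorem eval (p : ℕ[X]) {f : γ → ℕ} (hf : PolyBdd f) : PolyBdd fun c => p.eval (f c) := by
  obtain ⟨q, hq⟩ := hf
  exact ⟨p.comp q, fun c => by simpa using eval_nat_mono p (hq c)⟩

theorem comp {f : β → ℕ} {g : γ → β} (hf : PolyBdd f) (hg : PolyBdd fun c => esize (g c)) :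
    PolyBdd fun c => f (g c) := by
  obtain ⟨p, hp⟩ := hf
  exact (hg.eval p).mono fun c => hp _

end PolyBdd

/-! ### Functions computable in polynomial time -/

/-- `f` is computed in polynomial time by a program that tosses no coins. -/
@[fun_prop]
def PolyTime (f : α → β) : Prop :=
  -- The output size is bounded separately: `cons x x x` roughly doubles a tree in one step, so few
  -- steps can produce a tree of exponential size.
  (PolyBdd fun a => esize (f a)) ∧
  ∃ (c : Cmd) (T : α → ℕ), PolyBdd T ∧ ∀ a ω, ∃ s t,
    Exec c (initStore (Enc.enc a)) ω s ω t ∧ s 0 = Enc.enc (f a) ∧ t ≤ T a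

theorem esize_prod (a : α) (b : β) : esize (a, b) = esize a + esize b + 1 := rfl

theorem esize_nil : esize ([] : List α) = 1 := rfl

theorem esize_cons (a : α) (l : List α) : esize (a :: l) = esize a + esize l + 1 := rfl

theorem exec_call {x y : ℕ} {c : Cmd} {s s' : Store} {ω ω' : Coins} {t : ℕ} {d : Data}
    (hd : s y = d) (h : Exec c (initStore d) ω s' ω' t) :
    Exec (.call x c y) s ω (Function.update s x (s' 0)) ω' (t + 1) :=
  .call (by rwa [hd])

namespace PolyTime

theorem bdd {f : α → β} (hf : PolyTime f) : PolyBdd fun a => esize (f a) := hf.1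

theorem congr {f g : α → β} (hf : PolyTime f) (h : ∀ a, f a = g a) : PolyTime g :=
  funext h ▸ hf

@[fun_prop]
theorem id' : PolyTime fun a : α => a :=
  ⟨.size, .copy 0 0, fun _ => 1, .const 1,
    fun a ω => ⟨_, _, .copy 0 0 _ _, by simp [initStore], le_rfl⟩⟩

/-- Functions that leave the representation unchanged. -/
theorem of_enc_eq {f : α → β} (h : ∀ a, Enc.enc (f a) = Enc.enc a) : PolyTime f :=
  ⟨PolyBdd.size.mono fun a => by simp [esize, h], .copy 0 0, fun _ => 1, .const 1,
    fun a ω => ⟨_, _, .copy 0 0 _ _, by simp [initStore, h], le_rfl⟩⟩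

/-- The subtrees are built by subroutine calls, whose private variables keep the two halves from
overwriting each other. -/
theorem exists_exec_const (d : Data) (x : ℕ) : ∃ c t, ∀ s ω, ∃ s',
    Exec c s ω s' ω t ∧ s' x = d := by
  induction d generalizing x with
  | nil => exact ⟨.setNil x, 1, fun s ω => ⟨_, .setNil x s ω, by simp⟩⟩
  | cons a b iha ihb =>
    obtain ⟨ca, ta, ha⟩ := iha 0
    obtain ⟨cb, tb, hb⟩ := ihb 0
    refine ⟨.seq (.call 1 ca 0) (.seq (.call 2 cb 0) (.cons x 1 2)), (ta + 1) + ((tb + 1) + 1),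
      fun s ω => ?_⟩
    obtain ⟨sa, hsa, hsa'⟩ := ha (initStore (s 0)) ω
    obtain ⟨sb, hsb, hsb'⟩ := hb (initStore (Function.update s 1 (sa 0) 0)) ω
    exact ⟨_, .seq (.call hsa) (.seq (.call hsb) (.cons x 1 2 _ ω)), by simp [hsa', hsb']⟩

@[fun_prop]
theorem const (b : β) : PolyTime fun _ : α => b := by
  obtain ⟨c, t, h⟩ := exists_exec_const (Enc.enc b) 0
  refine ⟨.const _, c, fun _ => t, .const t, fun a ω => ?_⟩
  obtain ⟨s', hs, hs'⟩ := h (initStore (Enc.enc a)) ω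
  exact ⟨s', t, hs, hs', le_rfl⟩

@[fun_prop]
theorem comp {g : β → γ} {f : α → β} (hg : PolyTime g) (hf : PolyTime f) :
    PolyTime fun a => g (f a) := by
  obtain ⟨hgb, cg, Tg, hTg, hg⟩ := hg
  obtain ⟨hfb, cf, Tf, hTf, hf⟩ := hf
  refine ⟨hgb.comp hfb, .seq (.call 0 cf 0) (.call 0 cg 0), fun a => (Tf a + 1) + (Tg (f a) + 1),
    (hTf.add (.const 1)).add ((hTg.comp hfb).add (.const 1)), fun a ω => ?_⟩
  obtain ⟨s, t, h, hs, ht⟩ := hf a ω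
  obtain ⟨s', t', h', hs', ht'⟩ := hg (f a) ω
  refine ⟨_, (t + 1) + (t' + 1), .seq (exec_call ?_ h) (exec_call ?_ h'), ?_, by dsimp only; omega⟩
  · simp [initStore]
  · simp [hs]
  · simpa using hs'

/-! ### Pairs, elementary list operations and branching -/

@[fun_prop]
theorem prodMk {f : α → β} {g : α → γ} (hf : PolyTime f) (hg : PolyTime g) :
    PolyTime fun a => (f a, g a) := by
  obtain ⟨hgb, cg, Tg, hTg, hg⟩ := hg
  obtain ⟨hfb, cf, Tf, hTf, hf⟩ := hf
  refine ⟨((hfb.add hgb).add (.const 1)).mono fun a => le_rfl,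
    .seq (.call 1 cf 0) (.seq (.call 2 cg 0) (.cons 0 1 2)), fun a => Tf a + Tg a + 3,
    (hTf.add hTg).add (.const 3), fun a ω => ?_⟩
  obtain ⟨s, t, h, hs, ht⟩ := hf a ω
  obtain ⟨s', t', h', hs', ht'⟩ := hg a ω
  refine ⟨_, (t + 1) + ((t' + 1) + 1), .seq (exec_call ?_ h)
    (.seq (exec_call ?_ h') (.cons 0 1 2 _ ω)), ?_, by dsimp only; omega⟩
  · simp [initStore]
  · simp [initStore]
  · simp [hs, hs', Enc.enc]

@[fun_prop]
theorem fst : PolyTime fun p : α × β => p.1 :=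
  ⟨PolyBdd.size.mono fun p => by rw [← Prod.mk.eta (p := p), esize_prod]; dsimp only; omega,
    .head 0 0, fun _ => 1, .const 1,
    fun a ω => ⟨_, _, .head 0 0 _ _, by simp [initStore, Enc.enc, Data.fst], le_rfl⟩⟩

@[fun_prop]
theorem snd : PolyTime fun p : α × β => p.2 :=
  ⟨PolyBdd.size.mono fun p => by rw [← Prod.mk.eta (p := p), esize_prod]; dsimp only; omega,
    .tail 0 0, fun _ => 1, .const 1,
    fun a ω => ⟨_, _, .tail 0 0 _ _, by simp [initStore, Enc.enc, Data.snd], le_rfl⟩⟩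

@[fun_prop]
theorem list_cons {f : γ → α} {g : γ → List α} (hf : PolyTime f) (hg : PolyTime g) :
    PolyTime fun c => f c :: g c :=
  (of_enc_eq (f := fun p : α × List α => p.1 :: p.2) fun _ => rfl).comp (hf.prodMk hg)

@[fun_prop]
theorem list_tail {f : γ → List α} (hf : PolyTime f) : PolyTime fun c => (f c).tail := by
  refine comp (g := fun l : List α => l.tail) ⟨PolyBdd.size.mono fun l => ?_, .tail 0 0,
    fun _ => 1, .const 1, fun a ω => ⟨_, _, .tail 0 0 _ _, ?_, le_rfl⟩⟩ hf
  · cases l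
    · exact le_rfl
    · simp only [List.tail_cons, esize_cons]; omega
  · cases a <;> simp [initStore, Enc.enc, Data.snd, encList]

/-- Branching on whether a representation is `nil`. -/
theorem branch {f : γ → α} {g h : γ → β} {r : γ → β} (hf : PolyTime f) (hg : PolyTime g)
    (hh : PolyTime h) (h₁ : ∀ c, Enc.enc (f c) ≠ .nil → r c = g c)
    (h₀ : ∀ c, Enc.enc (f c) = .nil → r c = h c) : PolyTime r := by
  obtain ⟨hfb, cf, Tf, hTf, hf⟩ := hf
  obtain ⟨hgb, cg, Tg, hTg, hg⟩ := hg
  obtain ⟨hhb, ch, Th, hTh, hh⟩ := hh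
  refine ⟨(hgb.add hhb).mono fun c => ?_,
    .seq (.call 1 cf 0) (.ite 1 (.call 0 cg 0) (.call 0 ch 0)),
    fun c => Tf c + Tg c + Th c + 3, ((hTf.add hTg).add hTh).add (.const 3), fun c ω => ?_⟩
  · by_cases hc : Enc.enc (f c) = .nil
    · rw [h₀ c hc]; omega
    · rw [h₁ c hc]; omega
  obtain ⟨s, t, e, hs, ht⟩ := hf c ω
  by_cases hc : Enc.enc (f c) = .nil
  · obtain ⟨s', t', e', hs', ht'⟩ := hh c ω
    refine ⟨_, (t + 1) + ((t' + 1) + 1), .seq (exec_call ?_ e)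
      (.iteElse ?_ (exec_call ?_ e')), ?_, by dsimp only; omega⟩
    · simp [initStore]
    · simp [hs, hc]
    · simp [initStore]
    · simp [hs', h₀ c hc]
  · obtain ⟨s', t', e', hs', ht'⟩ := hg c ω
    refine ⟨_, (t + 1) + ((t' + 1) + 1), .seq (exec_call ?_ e)
      (.iteThen ?_ (exec_call ?_ e')), ?_, by dsimp only; omega⟩
    · simp [initStore]
    · simp [hs, hc]
    · simp [initStore]
    · simp [hs', h₁ c hc]

theorem enc_bool_eq_nil {b : Bool} : Enc.enc b = .nil ↔ b = false := by
  cases b <;> simp [Enc.enc, encBool]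

theorem enc_list_eq_nil {l : List α} : Enc.enc l = .nil ↔ l = [] := by
  cases l <;> simp [Enc.enc, encList]

@[fun_prop]
theorem cond {f : γ → Bool} {g h : γ → β} (hf : PolyTime f) (hg : PolyTime g)
    (hh : PolyTime h) : PolyTime fun c => bif f c then g c else h c :=
  branch hf hg hh (fun c hc => by simp_all [enc_bool_eq_nil])
    (fun c hc => by simp_all [enc_bool_eq_nil])

@[fun_prop]
theorem isEmpty {f : γ → List α} (hf : PolyTime f) : PolyTime fun c => (f c).isEmpty :=
  branch hf (const false) (const true) (fun c hc => by simpa [enc_list_eq_nil] using hc)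
    (fun c hc => by simpa [enc_list_eq_nil] using hc)

-- `branch` does not apply, because the bare instruction `head` is not a function into `α`: on an
-- empty list it yields `nil`, which need not represent an element.
@[fun_prop]
theorem headD {f : γ → List α} (d : α) (hf : PolyTime f) : PolyTime fun c => (f c).headD d := by
  obtain ⟨hfb, cf, Tf, hTf, hf'⟩ := id hf
  have hb : PolyBdd fun c => esize ((f c).headD d) := (hfb.add (.const (esize d))).mono fun c => by
    cases f c
    · simp
    · simp only [List.headD_cons, esize_cons]; omega
  obtain ⟨cd, t₀, hd⟩ := exists_exec_const (Enc.enc d) 0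
  refine ⟨hb, .seq (.call 0 cf 0) (.ite 0 (.head 0 0) cd), fun c => Tf c + t₀ + 3,
    (hTf.add (.const t₀)).add (.const 3), fun c ω => ?_⟩
  obtain ⟨s, t, e, hs, ht⟩ := hf' c ω
  cases hc : f c with
  | nil =>
    obtain ⟨s', e', hs'⟩ := hd (Function.update (initStore (Enc.enc c)) 0 (s 0)) ω
    refine ⟨s', (t + 1) + (t₀ + 1), .seq (exec_call ?_ e) (.iteElse ?_ e'), ?_,
      by dsimp only; omega⟩
    · simp [initStore]
    · simp [hs, hc, Enc.enc, encList]
    · simpa [hc] using hs'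
  | cons a l =>
    refine ⟨_, (t + 1) + (1 + 1), .seq (exec_call ?_ e) (.iteThen ?_ (.head 0 0 _ ω)), ?_,
      by dsimp only; omega⟩
    · simp [initStore]
    · simp [hs, hc, Enc.enc, encList]
    · simp [hs, hc, Enc.enc, encList, Data.fst]

/-! ### Loops -/

/-- The program for a left fold: the context is in variable `0`, the list in variable `1` and the
accumulator in variable `2`. -/
def foldBody (c : Cmd) : Cmd :=
  .seq (.head 3 1) (.seq (.tail 1 1) (.seq (.cons 3 2 3) (.seq (.cons 3 0 3) (.call 2 c 3))))

/-- The cost of a step depends on the accumulator, so `B` is required to bound it at every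
accumulator that actually occurs. The 6 counts the five overhead steps of `foldBody` and the loop
test; the final 1 is the failing test. -/
theorem exec_fold {g : γ → σ → α → σ} {c : Cmd} {T : γ × σ × α → ℕ}
    (hc : ∀ p ω, ∃ s t, Exec c (initStore (Enc.enc p)) ω s ω t ∧
      s 0 = Enc.enc (g p.1 p.2.1 p.2.2) ∧ t ≤ T p) (a : γ) (B : ℕ) (ω : Coins)
    (l : List α) (x : σ) (s : Store)
    (hB : ∀ l₁ y l₂, l = l₁ ++ y :: l₂ → T (a, l₁.foldl (g a) x, y) ≤ B)
    (h0 : s 0 = Enc.enc a) (h1 : s 1 = Enc.enc l) (h2 : s 2 = Enc.enc x) :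
    ∃ s' t, Exec (.while 1 (foldBody c)) s ω s' ω t ∧ s' 2 = Enc.enc (l.foldl (g a) x) ∧
      t ≤ l.length * (B + 6) + 1 := by
  induction l generalizing x s with
  | nil => exact ⟨s, 1, .whileDone (by simp [h1, Enc.enc, encList]), by simpa using h2, by simp⟩
  | cons y l ih =>
    obtain ⟨s₁, t₁, e₁, hs₁, ht₁⟩ := hc (a, x, y) ω
    have hB₁ : T (a, x, y) ≤ B := hB [] y l rfl
    obtain ⟨u, hu, hu0, hu1, hu2⟩ : ∃ u,
        Exec (foldBody c) s ω u ω (1 + (1 + (1 + (1 + (t₁ + 1))))) ∧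
        u 0 = Enc.enc a ∧ u 1 = Enc.enc l ∧ u 2 = Enc.enc (g a x y) := by
      refine ⟨_, .seq (.head 3 1 s ω) (.seq (.tail 1 1 _ ω) (.seq (.cons 3 2 3 _ ω)
        (.seq (.cons 3 0 3 _ ω) (exec_call ?_ e₁)))), ?_, ?_, ?_⟩
      · simp [h0, h1, h2, Enc.enc, encList, Data.fst]
      · simp [h0]
      · simp [h1, Enc.enc, encList, Data.snd]
      · simp [hs₁]
    obtain ⟨s', t, e, hs', ht⟩ := ih (g a x y) u
      (fun l₁ z l₂ h => hB (y :: l₁) z l₂ (by simp [h])) hu0 hu1 hu2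
    refine ⟨s', (1 + (1 + (1 + (1 + (t₁ + 1))))) + t + 1,
      .whileStep (by simp [h1, Enc.enc, encList]) hu e, by simpa using hs', ?_⟩
    · have : (t₁ + 6) + (l.length * (B + 6) + 1) ≤ (y :: l).length * (B + 6) + 1 := by
        rw [List.length_cons, Nat.add_mul]; omega
      omega

theorem length_le_esize (l : List α) : l.length ≤ esize l := by
  induction l with
  | nil => simp
  | cons a l ih => rw [List.length_cons, esize_cons]; omega

theorem esize_le_of_mem {a : α} {l : List α} (h : a ∈ l) : esize a ≤ esize l := by
  induction l with
  | nil => simp at h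
  | cons b l ih =>
    rw [esize_cons]
    rcases List.mem_cons.1 h with rfl | h
    · omega
    · have := ih h; omega

/-- A polynomial-time step may double the accumulator, so iterating it need not stay polynomial;
hence the explicit size bound on the fold over every prefix. -/
theorem foldl_of_bdd {f : γ → List α} {i : γ → σ} {g : γ → σ → α → σ} {b : γ → ℕ}
    (hf : PolyTime f) (hi : PolyTime i) (hg : PolyTime fun p : γ × σ × α => g p.1 p.2.1 p.2.2)
    (hb : PolyBdd b) (h : ∀ c l, l <+: f c → esize (l.foldl (g c) (i c)) ≤ b c) :
    PolyTime fun c => (f c).foldl (g c) (i c) := by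
  obtain ⟨hfb, cf, Tf, hTf, hf⟩ := hf
  obtain ⟨hib, ci, Ti, hTi, hi⟩ := hi
  obtain ⟨hgb, cg, Tg, ⟨p, hp⟩, hg⟩ := hg
  -- The argument of `p` bounds the size of the triple of context, accumulator and list element, the
  -- two 1s being the pairing nodes.
  let B : γ → ℕ := fun c => p.eval (esize c + (b c + esize (f c) + 1) + 1)
  have hB : PolyBdd B :=
    ((PolyBdd.size.add ((hb.add hfb).add (.const 1))).add (.const 1)).eval p
  refine ⟨hb.mono fun c => h c _ (List.prefix_refl _),
    .seq (.call 1 cf 0) (.seq (.call 2 ci 0) (.seq (.while 1 (foldBody cg)) (.copy 0 2))),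
    fun c => Tf c + Ti c + esize (f c) * (B c + 6) + 4,
    ((hTf.add hTi).add (hfb.mul (hB.add (.const 6)))).add (.const 4), fun c ω => ?_⟩
  obtain ⟨s₁, t₁, e₁, hs₁, ht₁⟩ := hf c ω
  obtain ⟨s₂, t₂, e₂, hs₂, ht₂⟩ := hi c ω
  obtain ⟨s₃, t₃, e₃, hs₃, ht₃⟩ := exec_fold hg c (B c) ω (f c) (i c)
    (Function.update (Function.update (initStore (Enc.enc c)) 1 (s₁ 0)) 2 (s₂ 0))
    (fun l₁ y l₂ hl => (hp _).trans (eval_nat_mono p (by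
      have h1 := h c l₁ ⟨_, hl.symm⟩
      have h2 : esize y ≤ esize (f c) := esize_le_of_mem (by simp [hl])
      rw [esize_prod, esize_prod]
      omega)))
    (by simp [initStore]) (by simp [hs₁]) (by simp [hs₂])
  refine ⟨_, (t₁ + 1) + ((t₂ + 1) + (t₃ + 1)), .seq (exec_call ?_ e₁)
    (.seq (exec_call ?_ e₂) (.seq e₃ (.copy 0 2 _ ω))), ?_, ?_⟩
  · simp [initStore]
  · simp [initStore]
  · simpa using hs₃
  · have := Nat.mul_le_mul_right (B c + 6) (length_le_esize (f c))
    dsimp only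
    omega

/-- Folds in which every step enlarges the accumulator by a bounded amount. -/
theorem foldl {f : γ → List α} {i : γ → σ} {g : γ → σ → α → σ} {b : γ × α → ℕ}
    (hf : PolyTime f) (hi : PolyTime i) (hg : PolyTime fun p : γ × σ × α => g p.1 p.2.1 p.2.2)
    (hb : PolyBdd b) (h : ∀ c x a, esize (g c x a) ≤ esize x + b (c, a)) :
    PolyTime fun c => (f c).foldl (g c) (i c) := by
  obtain ⟨p, hp⟩ := hb
  refine foldl_of_bdd hf hi hg (b := fun c => esize (i c) + esize (f c) *
    p.eval (esize c + esize (f c) + 1))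
    (hi.bdd.add (hf.bdd.mul (((PolyBdd.size.add hf.bdd).add (.const 1)).eval p))) fun c l hl => ?_
  have key : ∀ (l : List α) (x : σ), (∀ a ∈ l, a ∈ f c) → esize (l.foldl (g c) x) ≤
      esize x + l.length * p.eval (esize c + esize (f c) + 1) := by
    intro l
    induction l with
    | nil => simp
    | cons a l ih =>
      intro x hl
      have h1 := ih (g c x a) fun a ha => hl a (by simp [ha])
      have h2 := h c x a
      have h3 : b (c, a) ≤ p.eval (esize c + esize (f c) + 1) :=
        (hp _).trans (eval_nat_mono p (by
          rw [esize_prod]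
          have := esize_le_of_mem (hl a (by simp))
          omega))
      rw [List.foldl_cons, List.length_cons, Nat.add_mul]
      omega
  refine (key l (i c) fun a ha => hl.subset ha).trans ?_
  gcongr
  exact (hl.length_le).trans (length_le_esize _)

/-! ### Truth values and lists -/

@[fun_prop]
theorem and {f g : γ → Bool} (hf : PolyTime f) (hg : PolyTime g) :
    PolyTime fun c => f c && g c := by
  refine (hf.cond hg (const false)).congr fun c => ?_
  cases f c <;> rfl

@[fun_prop]
theorem or {f g : γ → Bool} (hf : PolyTime f) (hg : PolyTime g) :
    PolyTime fun c => f c || g c := by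
  refine (hf.cond (const true) hg).congr fun c => ?_
  cases f c <;> rfl

@[fun_prop]
theorem not {f : γ → Bool} (hf : PolyTime f) : PolyTime fun c => !f c := by
  refine (hf.cond (const false) (const true)).congr fun c => ?_
  cases f c <;> rfl

@[fun_prop]
theorem bool_beq {f g : γ → Bool} (hf : PolyTime f) (hg : PolyTime g) :
    PolyTime fun c => f c == g c := by
  refine (hf.cond hg hg.not).congr fun c => ?_
  cases f c <;> simp

/-- A loop that conses onto its accumulator reverses the list; this one loop yields `reverse`,
`append` and `map`. -/
theorem foldl_cons {f : γ → List α} {i : γ → List β} {g : γ → α → β} (hf : PolyTime f)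
    (hi : PolyTime i) (hg : PolyTime fun p : γ × α => g p.1 p.2) :
    PolyTime fun c => ((f c).map (g c)).reverse ++ i c := by
  refine (foldl (g := fun c acc x => g c x :: acc) (b := fun p => esize (g p.1 p.2) + 1) hf hi
    (list_cons (hg.comp (f := fun p : γ × List β × α => (p.1, p.2.2)) (by fun_prop))
      (by fun_prop)) (hg.bdd.add (.const 1))
    fun c x a => by rw [esize_cons]; dsimp only; omega).congr fun c => ?_
  have (l : List α) (r : List β) :
      l.foldl (fun acc x => g c x :: acc) r = (l.map (g c)).reverse ++ r := by
    induction l generalizing r with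
    | nil => rfl
    | cons a l ih => simp [ih]
  exact this _ _

@[fun_prop]
theorem reverse {f : γ → List α} (hf : PolyTime f) : PolyTime fun c => (f c).reverse :=
  (foldl_cons hf (const []) (g := fun _ a => a) (by fun_prop)).congr fun c => by simp

@[fun_prop]
theorem append {f g : γ → List α} (hf : PolyTime f) (hg : PolyTime g) :
    PolyTime fun c => f c ++ g c :=
  (foldl_cons hf.reverse hg (g := fun _ a => a) (by fun_prop)).congr fun c => by simp

@[fun_prop]
theorem map {f : γ → List α} {g : γ → α → β} (hf : PolyTime f)
    (hg : PolyTime fun p : γ × α => g p.1 p.2) : PolyTime fun c => (f c).map (g c) :=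
  (foldl_cons hf (const []) hg).reverse.congr fun c => by simp

theorem esize_append (l r : List α) : esize (l ++ r) + 1 = esize l + esize r := by
  induction l with
  | nil => rw [esize_nil, List.nil_append]; omega
  | cons a l ih => rw [List.cons_append, esize_cons, esize_cons]; omega

@[fun_prop]
theorem flatMap {f : γ → List α} {g : γ → α → List β} (hf : PolyTime f)
    (hg : PolyTime fun p : γ × α => g p.1 p.2) : PolyTime fun c => (f c).flatMap (g c) := by
  refine (foldl (g := fun c acc x => acc ++ g c x) (b := fun p => esize (g p.1 p.2)) hf (const [])
    (append (by fun_prop) (hg.comp (f := fun p : γ × List β × α => (p.1, p.2.2)) (by fun_prop)))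
    hg.bdd
    fun c x a => by have := esize_append x (g c a); dsimp only; omega).congr fun c => ?_
  have (l : List α) (r : List β) : l.foldl (fun acc x => acc ++ g c x) r =
      r ++ l.flatMap (g c) := by
    induction l generalizing r with
    | nil => simp
    | cons a l ih => simp [ih]
  simp [this]

theorem esize_bool_le (b : Bool) : esize b ≤ 3 := by
  cases b <;> simp [esize, Enc.enc, encBool, Data.size]

@[fun_prop]
theorem any {f : γ → List α} {g : γ → α → Bool} (hf : PolyTime f)
    (hg : PolyTime fun p : γ × α => g p.1 p.2) : PolyTime fun c => (f c).any (g c) := by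
  refine (foldl (g := fun c acc x => acc || g c x) (b := fun p => 3) hf (const false)
    (or (by fun_prop) (hg.comp (f := fun p : γ × Bool × α => (p.1, p.2.2)) (by fun_prop)))
    (.const 3) fun c x a => (esize_bool_le _).trans (by omega)).congr fun c => ?_
  have (l : List α) (r : Bool) : l.foldl (fun acc x => acc || g c x) r = (r || l.any (g c)) := by
    induction l generalizing r with
    | nil => simp
    | cons a l ih => simp [ih, Bool.or_assoc]
  simp [this]

@[fun_prop]
theorem all {f : γ → List α} {g : γ → α → Bool} (hf : PolyTime f)
    (hg : PolyTime fun p : γ × α => g p.1 p.2) : PolyTime fun c => (f c).all (g c) := by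
  refine (hf.any (g := fun c a => !g c a) hg.not).not.congr fun c => ?_
  simp [List.all_eq_not_any_not]

/-! ### Natural numbers -/

theorem enc_nat (n : ℕ) : Enc.enc n = Enc.enc (List.replicate n false) := rfl

theorem esize_nat (n : ℕ) : esize n = 2 * n + 1 := by
  rw [esize, enc_nat]
  change esize _ = _
  induction n with
  | zero => rfl
  | succ n ih => 
    have : esize false = 1 := rfl
    rw [List.replicate_succ, esize_cons, ih, this]
    omega

theorem unary {f : γ → ℕ} (hf : PolyTime f) : PolyTime fun c => List.replicate (f c) false :=
  (of_enc_eq (f := fun n => List.replicate n false) fun _ => rfl).comp hf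

@[fun_prop]
theorem succ {f : γ → ℕ} (hf : PolyTime f) : PolyTime fun c => f c + 1 := by
  obtain ⟨h, c, T, hT, H⟩ := (const false).list_cons hf.unary
  -- In unary the successor has the same representation as the list with one more `false`, so the
  -- program for the list serves unchanged.
  exact ⟨h, c, T, hT, H⟩

theorem pred {f : γ → ℕ} (hf : PolyTime f) : PolyTime fun c => f c - 1 := by
  obtain ⟨h, c, T, hT, H⟩ := hf.unary.list_tail
  simp only [List.tail_replicate] at h H
  exact ⟨h, c, T, hT, H⟩

theorem isZero {f : γ → ℕ} (hf : PolyTime f) : PolyTime fun c => f c == 0 :=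
  hf.unary.isEmpty.congr fun c => by cases f c <;> simp [List.replicate_succ]

@[fun_prop]
theorem length {f : γ → List α} (hf : PolyTime f) : PolyTime fun c => (f c).length := by
  refine (foldl (g := fun _ n _ => n + 1) (b := fun _ => 2) hf (const 0) (by fun_prop)
    (.const 2) fun c x a => by rw [esize_nat, esize_nat]; omega).congr fun c => ?_
  have (l : List α) (n : ℕ) : l.foldl (fun n _ => n + 1) n = n + l.length := by
    induction l generalizing n with
    | nil => simp
    | cons a l ih => simp [ih]; omega
  simp [this]

theorem iterate {f : γ → ℕ} {i : γ → σ} {g : σ → σ} (hf : PolyTime f) (hi : PolyTime i)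
    (hg : PolyTime g) (k : ℕ) (h : ∀ x, esize (g x) ≤ esize x + k) :
    PolyTime fun c => g^[f c] (i c) := by
  refine (foldl (g := fun _ x _ => g x) (b := fun _ => k) hf.unary hi (by fun_prop)
    (.const k) fun c x a => h x).congr fun c => ?_
  have (n : ℕ) (x : σ) : (List.replicate n false).foldl (fun x _ => g x) x = g^[n] x := by
    induction n generalizing x with
    | zero => simp
    | succ n ih => simp [List.replicate_succ, ih]
  simp [this]

@[fun_prop]
theorem add {f g : γ → ℕ} (hf : PolyTime f) (hg : PolyTime g) : PolyTime fun c => f c + g c :=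
  (iterate (g := fun n => n + 1) hg hf (by fun_prop) 2 fun x => by
    rw [esize_nat, esize_nat]; omega).congr fun c => by simp

@[fun_prop]
theorem sub {f g : γ → ℕ} (hf : PolyTime f) (hg : PolyTime g) : PolyTime fun c => f c - g c :=
  (iterate (g := fun n => n - 1) hg hf id'.pred 0 fun x => by
    rw [esize_nat, esize_nat]; omega).congr fun c => by
      generalize f c = a
      generalize g c = b
      induction b with
      | zero => rfl
      | succ b ih => rw [Function.iterate_succ_apply', ih]; omega

@[fun_prop]
theorem nat_beq {f g : γ → ℕ} (hf : PolyTime f) (hg : PolyTime g) :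
    PolyTime fun c => f c == g c :=
  ((hf.sub hg).isZero.and (hg.sub hf).isZero).congr fun c => by
    rw [Bool.eq_iff_iff]; simp; omega

@[fun_prop]
theorem nat_lt {f g : γ → ℕ} (hf : PolyTime f) (hg : PolyTime g) :
    PolyTime fun c => decide (f c < g c) :=
  (hg.sub hf).isZero.not.congr fun c => by
    rw [Bool.eq_iff_iff]; simp; omega

@[fun_prop]
theorem getD {f : γ → List α} {i : γ → ℕ} (d : α) (hf : PolyTime f) (hi : PolyTime i) :
    PolyTime fun c => (f c).getD (i c) d :=
  ((iterate (g := fun l : List α => l.tail) hi hf (by fun_prop) 0 fun l => by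
    cases l
    · exact le_rfl
    · simp only [List.tail_cons, esize_cons]; omega).headD d).congr fun c => by
      generalize f c = l
      generalize i c = n
      induction n generalizing l with
      | zero => cases l <;> rfl
      | succ n ih => rw [Function.iterate_succ_apply, ih]; cases l <;> simp

@[fun_prop]
theorem range {f : γ → ℕ} (hf : PolyTime f) : PolyTime fun c => List.range (f c) := by
  -- The length of the accumulator serves as the counter. The increment then depends on the
  -- accumulator, so the quadratic bound `hsize` is used with `foldl_of_bdd`.
  have key (l : List Bool) : l.foldl (fun (acc : List ℕ) _ => acc.length :: acc) [] =
      (List.range l.length).reverse := by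
    induction l using List.reverseRecOn with
    | nil => rfl
    | append_singleton l a ih => simp [ih, List.range_succ]
  have hsize (n : ℕ) : esize (List.range n).reverse ≤ n * (2 * n + 2) + 1 := by
    induction n with
    | zero => simp [esize_nil]
    | succ n ih =>
      rw [List.range_succ, List.reverse_append, List.reverse_singleton, List.singleton_append,
        esize_cons, esize_nat]
      nlinarith
  refine (foldl_of_bdd (g := fun _ acc _ => acc.length :: acc)
    (b := fun c => esize (f c) * (2 * esize (f c) + 2) + 1) hf.unary (const []) (by fun_prop)
    ((hf.bdd.mul (((PolyBdd.const 2).mul hf.bdd).add (.const 2))).add (.const 1))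
    fun c l hl => ?_).reverse.congr fun c => ?_
  · rw [key]
    refine (hsize _).trans ?_
    have : l.length ≤ esize (f c) := by
      have := hl.length_le
      rw [List.length_replicate] at this
      rw [esize_nat]; omega
    gcongr
  · rw [key]; simp

@[fun_prop]
theorem bits_beq {f g : γ → List Bool} (hf : PolyTime f) (hg : PolyTime g) :
    PolyTime fun c => f c == g c := by
  refine PolyTime.congr (f := fun c => ((f c).length == (g c).length) &&
    (List.range (f c).length).all fun i => (f c).getD i false == (g c).getD i false)
    (by fun_prop) fun c => ?_
  rw [Bool.eq_iff_iff]
  simp only [Bool.and_eq_true, beq_iff_eq, List.all_eq_true, List.mem_range]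
  constructor
  · rintro ⟨h, h'⟩
    refine List.ext_getElem h fun i h₁ h₂ => ?_
    simpa [h₁, h₂] using h' i h₁
  · rintro h
    simp [h]

end PolyTime

/-! ### The algorithm -/

/-- Remove from `l` all but one of any elements that are identified by `eq`. -/
def representatives {α : Type} (eq : α → α → Bool) (l : List α) : List α :=
  l.foldl (fun acc x => bif acc.any (eq x) then acc else x :: acc) []

/-- The incidence matrix of the product of a hypergraph with itself. -/
def squareRows (E : List (List Bool)) : List (List Bool) :=
  E.flatMap fun e => E.map fun f => e ++ f

/-- Two columns of a matrix are equal. -/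
def sameColumn (E : List (List Bool)) (i j : ℕ) : Bool :=
  E.all fun r => r.getD i false == r.getD j false

/-- The entries of `r` at the positions listed in `idx`. -/
def restrictRow (idx : List ℕ) (r : List Bool) : List Bool :=
  idx.map fun i => r.getD i false

/-- Indices of pairwise distinct columns of the square of a matrix. -/
def columns (I : ℕ × List (List Bool)) : List ℕ :=
  representatives (sameColumn (squareRows I.2)) (List.range (I.1 + I.1))

/-- The square of a matrix with repeated rows and columns removed. -/
def reduced (I : ℕ × List (List Bool)) : ℕ × List (List Bool) :=
  ((columns I).length,
    representatives (fun r q => r == q) ((squareRows I.2).map fun r => restrictRow (columns I) r))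

/-- The intersection of two sets of vertices. -/
def meet (r C : List Bool) : List Bool :=
  (List.range r.length).map fun i => r.getD i false && C.getD i false

/-- Removal of vertex `i` from a set. -/
def clearBit (i : ℕ) (r : List Bool) : List Bool :=
  (List.range r.length).map fun j => !(j == i) && r.getD j false

/-- The down-compression of a set family along `i`. -/
def compressRows (i : ℕ) (F : List (List Bool)) : List (List Bool) :=
  F.map fun r => bif F.any (fun q => q == clearBit i r) then r else clearBit i r

/-- The down-compression of a set family along `0, …, m - 1`. -/
def compressAll (m : ℕ) (F : List (List Bool)) : List (List Bool) :=
  (List.range m).foldl (fun F i => compressRows i F) F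

/-- The set of all `i < n` such that `off + i` is one of the columns selected by `g` in `idx`. -/
def liftRow (idx : List ℕ) (n off : ℕ) (g : List Bool) : List Bool :=
  (List.range n).map fun i =>
    (List.range idx.length).any fun j => idx.getD j 0 == off + i && g.getD j false

/-- The size of a set. -/
def weight (r : List Bool) : ℕ := (r.filter fun b => b).length

/-- The larger of two sets. -/
def better (b r : List Bool) : List Bool := bif decide (weight b < weight r) then r else b

/-- The shattered sets extracted from a set `C` of vertices of the reduced square. -/
def candidates (I : ℕ × List (List Bool)) (C : List Bool) : List (List Bool) :=
  (compressAll (reduced I).1 ((reduced I).2.map fun r => meet r C)).flatMap fun g =>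
    [liftRow (columns I) I.1 0 g, liftRow (columns I) I.1 I.1 g]

/-- Update the best set found so far. -/
def improve (I : ℕ × List (List Bool)) (C b : List Bool) : List Bool :=
  (candidates I C).foldl better b

/-! ### Running time of its parts -/

/-- `false` is represented by a smaller tree than `true`, so clearing bits never enlarges a vector.
-/
theorem esize_bits_le_of_forall {r q : List Bool} (h : r.length = q.length)
    (h' : ∀ i, r.getD i false = true → q.getD i false = true) : esize r ≤ esize q := by
  induction r generalizing q with
  | nil => cases q with
    | nil => rfl
    | cons b q => simp at h
  | cons a r ih =>
    cases q with
    | nil => simp at h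
    | cons b q =>
      have h1 := ih (q := q) (by simpa using h) fun i hi => by
        simpa using h' (i + 1) (by simpa using hi)
      have h2 : esize a ≤ esize b := by
        have := h' 0
        revert this
        cases a <;> cases b <;> simp [esize, Enc.enc, encBool, Data.size]
      rw [esize_cons, esize_cons]
      omega

theorem getD_clearBit (i j : ℕ) (r : List Bool) :
    (clearBit i r).getD j false = (!(j == i) && r.getD j false) := by
  by_cases h : j < r.length
  · simp [clearBit, h]
  · simp [clearBit, h]

theorem length_clearBit (i : ℕ) (r : List Bool) : (clearBit i r).length = r.length := by
  simp [clearBit]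

theorem esize_compressRows_le (i : ℕ) (F : List (List Bool)) :
    esize (compressRows i F) ≤ esize F := by
  -- The test refers to the whole of `F`, so it is replaced by an arbitrary predicate before
  -- inducting on the list.
  have key (p : List Bool → Bool) (G : List (List Bool)) :
      esize (G.map fun r => bif p r then r else clearBit i r) ≤ esize G := by
    induction G with
    | nil => exact le_rfl
    | cons r G ih =>
      have h : esize (clearBit i r) ≤ esize r :=
        esize_bits_le_of_forall (length_clearBit i r) fun j hj => by
          rw [getD_clearBit, Bool.and_eq_true] at hj
          exact hj.2
      rw [List.map_cons, esize_cons, esize_cons]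
      cases p r
      · simp only [cond_false]; omega
      · simp only [cond_true]; omega
  exact key _ F

namespace PolyTime

@[fun_prop]
theorem filter {f : γ → List α} {g : γ → α → Bool} (hf : PolyTime f)
    (hg : PolyTime fun p : γ × α => g p.1 p.2) : PolyTime fun c => (f c).filter (g c) := by
  refine (hf.flatMap (g := fun c a => bif g c a then [a] else []) (by fun_prop)).congr fun c => ?_
  induction f c with
  | nil => rfl
  | cons a l ih => cases h : g c a <;> simp [h, ih]

theorem representatives {f : γ → List α} {eq : γ → α → α → Bool} (hf : PolyTime f)
    (heq : PolyTime fun p : γ × α × α => eq p.1 p.2.1 p.2.2) :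
    PolyTime fun c => representatives (eq c) (f c) := by
  refine foldl (g := fun c acc x => bif acc.any (eq c x) then acc else x :: acc)
    (b := fun p => esize p + 1) hf (const [])
    (cond (any (by fun_prop) (heq.comp
      (f := fun p : (γ × List α × α) × α => (p.1.1, p.1.2.2, p.2)) (by fun_prop)))
      (by fun_prop) (by fun_prop)) (PolyBdd.size.add (.const 1)) fun c x a => ?_
  rw [esize_prod]
  cases x.any (eq c a)
  · rw [cond_false, esize_cons]; omega
  · rw [cond_true]; omega

@[fun_prop]
theorem squareRows {f : γ → List (List Bool)} (hf : PolyTime f) :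
    PolyTime fun c => squareRows (f c) := by
  unfold PartialVC.squareRows
  fun_prop

@[fun_prop]
theorem sameColumn {f : γ → List (List Bool)} {i j : γ → ℕ} (hf : PolyTime f) (hi : PolyTime i)
    (hj : PolyTime j) : PolyTime fun c => sameColumn (f c) (i c) (j c) := by
  unfold PartialVC.sameColumn
  fun_prop

@[fun_prop]
theorem restrictRow {f : γ → List ℕ} {r : γ → List Bool} (hf : PolyTime f) (hr : PolyTime r) :
    PolyTime fun c => restrictRow (f c) (r c) := by
  unfold PartialVC.restrictRow
  fun_prop

@[fun_prop]
theorem columns {f : γ → ℕ × List (List Bool)} (hf : PolyTime f) :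
    PolyTime fun c => columns (f c) := by
  unfold PartialVC.columns
  exact representatives (by fun_prop) (by fun_prop)

@[fun_prop]
theorem reduced {f : γ → ℕ × List (List Bool)} (hf : PolyTime f) :
    PolyTime fun c => reduced (f c) := by
  unfold PartialVC.reduced
  exact prodMk (by fun_prop) (representatives (by fun_prop) (by fun_prop))

@[fun_prop]
theorem meet {f g : γ → List Bool} (hf : PolyTime f) (hg : PolyTime g) :
    PolyTime fun c => meet (f c) (g c) := by
  unfold PartialVC.meet
  fun_prop

@[fun_prop]
theorem clearBit {i : γ → ℕ} {f : γ → List Bool} (hi : PolyTime i) (hf : PolyTime f) :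
    PolyTime fun c => clearBit (i c) (f c) := by
  unfold PartialVC.clearBit
  fun_prop

@[fun_prop]
theorem compressRows {i : γ → ℕ} {f : γ → List (List Bool)} (hi : PolyTime i) (hf : PolyTime f) :
    PolyTime fun c => compressRows (i c) (f c) := by
  unfold PartialVC.compressRows
  fun_prop

-- No compression enlarges the matrix, so the fold has increment 0 and the iteration stays
-- polynomial.
@[fun_prop]
theorem compressAll {i : γ → ℕ} {f : γ → List (List Bool)} (hi : PolyTime i) (hf : PolyTime f) :
    PolyTime fun c => compressAll (i c) (f c) :=
  foldl (g := fun _ F i => PartialVC.compressRows i F) (b := fun _ => 0) (by fun_prop) hf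
    (by fun_prop) (.const 0) fun _ F i => esize_compressRows_le i F

@[fun_prop]
theorem liftRow {idx : γ → List ℕ} {n off : γ → ℕ} {g : γ → List Bool} (hidx : PolyTime idx)
    (hn : PolyTime n) (hoff : PolyTime off) (hg : PolyTime g) :
    PolyTime fun c => liftRow (idx c) (n c) (off c) (g c) := by
  unfold PartialVC.liftRow
  fun_prop

@[fun_prop]
theorem better {b r : γ → List Bool} (hb : PolyTime b) (hr : PolyTime r) :
    PolyTime fun c => better (b c) (r c) := by
  unfold PartialVC.better weight
  fun_prop

@[fun_prop]
theorem candidates {f : γ → ℕ × List (List Bool)} {C : γ → List Bool} (hf : PolyTime f)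
    (hC : PolyTime C) : PolyTime fun c => candidates (f c) (C c) := by
  unfold PartialVC.candidates
  exact flatMap (compressAll (fst.comp hf.reduced) (map (snd.comp hf.reduced) (by fun_prop)))
    (by fun_prop)

theorem improve {f : γ → ℕ × List (List Bool)} {C b : γ → List Bool} (hf : PolyTime f)
    (hC : PolyTime C) (hb : PolyTime b) : PolyTime fun c => improve (f c) (C c) (b c) := by
  refine foldl (g := fun _ b r => PartialVC.better b r) (b := fun p => esize p.2) (by fun_prop) hb
    (by fun_prop) snd.bdd fun c b r => ?_
  unfold PartialVC.better
  cases decide (weight b < weight r)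
  · rw [cond_false]; omega
  · rw [cond_true]; dsimp only; omega

end PolyTime

/-! ### Down-compressions -/

open Finset FinsetFamily

section Compression

variable {V : Type} [DecidableEq V]

/-- The result of successive down-compressions. -/
def iterCompress (l : List V) (𝒜 : Finset (Finset V)) : Finset (Finset V) :=
  l.foldl (fun 𝒜 a => Down.compression a 𝒜) 𝒜

theorem card_iterCompress (l : List V) (𝒜 : Finset (Finset V)) :
    #(iterCompress l 𝒜) = #𝒜 := by
  induction l generalizing 𝒜 with
  | nil => rfl
  | cons a l ih => exact (ih _).trans (Down.card_compression a 𝒜)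

theorem shatterer_iterCompress_subset (l : List V) (𝒜 : Finset (Finset V)) :
    (iterCompress l 𝒜).shatterer ⊆ 𝒜.shatterer := by
  induction l generalizing 𝒜 with
  | nil => rfl
  | cons a l ih => exact (ih _).trans (shatterer_compress_subset_shatterer a 𝒜)

/-- Later compressions do not destroy what earlier ones achieved; this is why one pass over the
vertices is enough to reach a down-set. -/
theorem erase_mem_compression_of_forall {a b : V} {𝒜 : Finset (Finset V)}
    (h : ∀ s ∈ 𝒜, s.erase a ∈ 𝒜) : ∀ s ∈ 𝓓 b 𝒜, s.erase a ∈ 𝓓 b 𝒜 := by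
  intro s hs
  rw [Down.mem_compression] at hs ⊢
  rcases hs with ⟨h₁, h₂⟩ | ⟨h₁, h₂⟩
  · left
    refine ⟨h s h₁, ?_⟩
    rw [erase_right_comm]
    exact h _ h₂
  · by_cases hab : a = b
    · subst hab
      by_cases ha : a ∈ s
      · exact absurd (by rwa [insert_eq_of_mem ha] at h₂) h₁
      · rw [erase_eq_of_notMem ha]
        exact .inr ⟨h₁, h₂⟩
    · by_cases hm : s.erase a ∈ 𝒜
      · by_cases hb : b ∈ s
        · exact absurd (by rwa [insert_eq_of_mem hb] at h₂) h₁
        · left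
          refine ⟨hm, ?_⟩
          rwa [erase_eq_of_notMem (fun hb' => hb (mem_of_mem_erase hb'))]
      · right
        refine ⟨hm, ?_⟩
        rw [← erase_insert_of_ne (Ne.symm hab)]
        exact h _ h₂

theorem erase_mem_iterCompress_of_forall {a : V} (l : List V) {𝒜 : Finset (Finset V)}
    (h : ∀ s ∈ 𝒜, s.erase a ∈ 𝒜) : ∀ s ∈ iterCompress l 𝒜, s.erase a ∈ iterCompress l 𝒜 := by
  induction l generalizing 𝒜 with
  | nil => exact h
  | cons b l ih => exact ih (erase_mem_compression_of_forall h)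

theorem erase_mem_iterCompress {a : V} {l : List V} (ha : a ∈ l) (𝒜 : Finset (Finset V)) :
    ∀ s ∈ iterCompress l 𝒜, s.erase a ∈ iterCompress l 𝒜 := by
  induction l generalizing 𝒜 with
  | nil => simp at ha
  | cons b l ih =>
    by_cases hab : a = b
    · subst hab
      exact erase_mem_iterCompress_of_forall l fun s hs =>
        Down.erase_mem_compression_of_mem_compression hs
    · exact ih (by simpa [hab] using ha) _

/-- A family compressed along every vertex is closed under subsets, so all its members are
shattered, and the original family shatters them as well. -/
theorem shatters_of_mem_iterCompress {l : List V} (hl : ∀ a, a ∈ l) {𝒜 : Finset (Finset V)}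
    {s : Finset V} (hs : s ∈ iterCompress l 𝒜) : 𝒜.Shatters s := by
  -- Closure under erasing single elements gives closure under subsets, written as differences `s \
  -- u`.
  have down : ∀ u : Finset V, s \ u ∈ iterCompress l 𝒜 := by
    intro u
    induction u using Finset.induction_on with
    | empty => simpa using hs
    | insert a u _ ih =>
      rw [sdiff_insert]
      exact erase_mem_iterCompress (hl a) 𝒜 _ ih
  refine mem_shatterer.1 (shatterer_iterCompress_subset l 𝒜 (mem_shatterer.2 fun t ht => ?_))
  refine ⟨s \ (s \ t), down _, ?_⟩
  rw [sdiff_sdiff_right_self, inf_eq_inter, inter_eq_right.2 ht, inter_eq_right.2 ht]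

/-- Complementation in `C` injects the sets below the middle layer into those above it, and the
middle layer is nonempty. That layer exists because `#C` is even, and it makes the inequality
strict. -/
theorem two_mul_card_filter_card_lt (C : Finset V) (d : ℕ) (hC : #C = 2 * d) :
    2 * #{s ∈ C.powerset | #s < d} < 2 ^ #C := by
  have h₁ : #{s ∈ C.powerset | #s < d} ≤ #{s ∈ C.powerset | d < #s} := by
    refine card_le_card_of_injOn (fun s => C \ s) ?_ ?_
    · intro s hs
      simp only [coe_filter, mem_powerset, Set.mem_ofPred_eq] at hs ⊢
      exact ⟨sdiff_subset, by rw [card_sdiff_of_subset hs.1]; omega⟩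
    · intro s hs t ht hst
      simp only [coe_filter, mem_powerset, Set.mem_ofPred_eq] at hs ht hst
      rw [← Finset.sdiff_sdiff_eq_self hs.1, hst, Finset.sdiff_sdiff_eq_self ht.1]
  obtain ⟨D, hD, hDd⟩ := exists_subset_card_eq (s := C) (n := d) (by omega)
  have h₂ : #{s ∈ C.powerset | #s < d} + #{s ∈ C.powerset | d < #s} < #C.powerset := by
    rw [← card_union_of_disjoint]
    · refine card_lt_card ⟨by simp [union_subset_iff], fun h => ?_⟩
      have := h (mem_powerset.2 hD)
      simp [hDd] at this
    · refine disjoint_filter.2 fun s _ h h' => ?_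
      omega
  rw [card_powerset] at h₂
  omega

/-- A family of at least half of the subsets of a set of `2 d` elements has, after compression,
a member of size `d`. -/
theorem exists_mem_iterCompress_card_ge {l : List V} (hl : ∀ a, a ∈ l) {𝒜 : Finset (Finset V)}
    {C : Finset V} {d : ℕ} (hC : #C = 2 * d) (h𝒜 : ∀ s ∈ 𝒜, s ⊆ C) (hcard : 2 ^ #C ≤ 2 * #𝒜) :
    ∃ s ∈ iterCompress l 𝒜, d ≤ #s := by
  by_contra! h
  -- Members of the compressed family are shattered by `𝒜`, hence contained in a member of `𝒜` and
  -- so in `C`.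
  have : #(iterCompress l 𝒜) ≤ #{s ∈ C.powerset | #s < d} := card_le_card fun s hs => by
    obtain ⟨u, hu, hsu⟩ := (shatters_of_mem_iterCompress hl hs).exists_superset
    simpa [h s hs] using hsu.trans (h𝒜 u hu)
  rw [card_iterCompress] at this
  have := two_mul_card_filter_card_lt C d hC
  omega

end Compression

/-! ### Bit vectors and matrices -/

/-- The set of positions of the ones in a bit vector. -/
def bitSet (m : ℕ) (r : List Bool) : Finset (Fin m) := {i | r.getD i false = true}

/-- The characteristic vector of a set. -/
def bits {m : ℕ} (C : Finset (Fin m)) : List Bool := List.ofFn fun i => decide (i ∈ C)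

variable {m : ℕ}

theorem mem_bitSet {r : List Bool} {i : Fin m} : i ∈ bitSet m r ↔ r.getD i false = true := by
  simp [bitSet]

theorem length_bits (C : Finset (Fin m)) : (bits C).length = m := by simp [bits]

theorem getD_bits (C : Finset (Fin m)) (i : Fin m) : (bits C).getD i false = decide (i ∈ C) := by
  simp [bits]

theorem bitSet_bits (C : Finset (Fin m)) : bitSet m (bits C) = C := by
  ext i
  rw [mem_bitSet, getD_bits, decide_eq_true_iff]

theorem bitSet_injective {r q : List Bool} (hr : r.length = m) (hq : q.length = m)
    (h : bitSet m r = bitSet m q) : r = q := by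
  refine List.ext_getElem (hr.trans hq.symm) fun i h₁ h₂ => ?_
  have := Finset.ext_iff.1 h ⟨i, hr ▸ h₁⟩
  rw [mem_bitSet, mem_bitSet, ← Bool.eq_iff_iff] at this
  simpa [h₁, h₂] using this

theorem bits_bitSet {r : List Bool} (hr : r.length = m) : bits (bitSet m r) = r :=
  bitSet_injective (length_bits _) hr (bitSet_bits _)

theorem card_bitSet {r : List Bool} (hr : r.length = m) : #(bitSet m r) = weight r := by
  induction r generalizing m with
  | nil => subst hr; rfl
  | cons b r ih =>
    subst hr
    have := ih rfl
    change #{i : Fin (r.length + 1) | _} = _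
    rw [Fin.card_filter_univ_succ']
    simp only [bitSet] at this
    cases b <;> simpa [weight, Function.comp_def, add_comm] using this

theorem card_eq_weight_bits (C : Finset (Fin m)) : weight (bits C) = #C := by
  rw [← card_bitSet (length_bits C), bitSet_bits]

/-- The set of columns `Y` of a matrix is shattered by the rows. -/
def MShatters (E : List (List Bool)) (Y : Finset ℕ) : Prop :=
  ∀ t : ℕ → Bool, ∃ r ∈ E, ∀ i ∈ Y, r.getD i false = t i

/-- With columns indexed by `ℕ`, shattered sets move between a matrix, its square and the reduced
square without casts between `Fin` types. -/
theorem shatters_iff_mShatters {E : List (List Bool)} {Y : Finset (Fin m)} :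
    (E.map (bitSet m)).toFinset.Shatters Y ↔ MShatters E (Y.map Fin.valEmbedding) := by
  constructor
  · intro h t
    obtain ⟨u, hu, hYu⟩ := h (t := {i ∈ Y | t i = true}) (filter_subset _ _)
    simp only [List.mem_toFinset, List.mem_map] at hu
    obtain ⟨r, hr, rfl⟩ := hu
    refine ⟨r, hr, fun j hj => ?_⟩
    obtain ⟨i, hi, rfl⟩ := mem_map.1 hj
    have := Finset.ext_iff.1 hYu i
    rw [mem_inter, mem_filter, mem_bitSet] at this
    rw [Bool.eq_iff_iff]
    exact ⟨fun h => (this.1 ⟨hi, h⟩).2, fun h => (this.2 ⟨hi, h⟩).2⟩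
  · intro h t ht
    obtain ⟨r, hr, hrt⟩ := h fun j => decide (∃ i ∈ t, i.val = j)
    refine ⟨bitSet m r, by simpa using ⟨r, hr, rfl⟩, ?_⟩
    ext i
    rw [mem_inter, mem_bitSet]
    constructor
    · rintro ⟨hi, hri⟩
      rw [hrt i (mem_map_of_mem _ hi), decide_eq_true_iff] at hri
      obtain ⟨j, hj, hji⟩ := hri
      rwa [← Fin.ext hji]
    · intro hi
      refine ⟨ht hi, ?_⟩
      rw [hrt i (mem_map_of_mem _ (ht hi)), decide_eq_true_iff]
      exact ⟨i, hi, rfl⟩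

/-! ### The square of a matrix -/

theorem mem_squareRows {E : List (List Bool)} {r : List Bool} :
    r ∈ squareRows E ↔ ∃ e ∈ E, ∃ f ∈ E, e ++ f = r := by
  simp [squareRows]

theorem MShatters.of_squareRows_left {E : List (List Bool)} {n : ℕ} (hE : ∀ e ∈ E, e.length = n)
    {S Y : Finset ℕ} (hS : MShatters (squareRows E) S) (hY : ∀ i ∈ Y, i < n ∧ i ∈ S) :
    MShatters E Y := by
  intro t
  obtain ⟨r, hr, hrt⟩ := hS t
  obtain ⟨e, he, f, hf, rfl⟩ := mem_squareRows.1 hr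
  refine ⟨e, he, fun i hi => ?_⟩
  rw [← hrt i (hY i hi).2, List.getD_append _ _ _ _ (by rw [hE e he]; exact (hY i hi).1)]

theorem MShatters.of_squareRows_right {E : List (List Bool)} {n : ℕ} (hE : ∀ e ∈ E, e.length = n)
    {S Y : Finset ℕ} (hS : MShatters (squareRows E) S) (hY : ∀ i ∈ Y, n + i ∈ S) :
    MShatters E Y := by
  intro t
  -- Only the positions `n + i` are used, where the truncated subtraction returns `i`.
  obtain ⟨r, hr, hrt⟩ := hS fun i => t (i - n)
  obtain ⟨e, he, f, hf, rfl⟩ := mem_squareRows.1 hr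
  refine ⟨f, hf, fun i hi => ?_⟩
  have := hrt _ (hY i hi)
  rw [List.getD_append_right _ _ _ _ (by rw [hE e he]; omega), hE e he] at this
  simpa using this

/-- The rows of the two halves are chosen independently, so patterns on `D` and on its translate by
`n` can be realised together. -/
theorem MShatters.exists_squareRows {E : List (List Bool)} {n : ℕ} (hE : ∀ e ∈ E, e.length = n)
    {D : Finset ℕ} (hD : ∀ i ∈ D, i < n) (h : MShatters E D) :
    ∃ S : Finset ℕ, #S = 2 * #D ∧ (∀ i ∈ S, i < n + n) ∧ MShatters (squareRows E) S := by
  refine ⟨D ∪ D.map (addLeftEmbedding n), ?_, ?_, ?_⟩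
  · rw [card_union_of_disjoint, card_map, two_mul]
    rw [disjoint_left]
    intro i hi hi'
    have := hD i hi
    obtain ⟨j, hj, rfl⟩ := mem_map.1 hi'
    simp at this
  · intro i hi
    rcases mem_union.1 hi with hi | hi
    · have := hD i hi; omega
    · obtain ⟨j, hj, rfl⟩ := mem_map.1 hi
      have := hD j hj
      simpa using this
  · intro t
    obtain ⟨e, he, het⟩ := h t
    obtain ⟨f, hf, hft⟩ := h fun i => t (n + i)
    refine ⟨e ++ f, mem_squareRows.2 ⟨e, he, f, hf, rfl⟩, fun i hi => ?_⟩
    rcases mem_union.1 hi with hi | hi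
    · rw [List.getD_append _ _ _ _ (by rw [hE e he]; exact hD i hi), het i hi]
    · obtain ⟨j, hj, rfl⟩ := mem_map.1 hi
      simp only [addLeftEmbedding_apply]
      rw [List.getD_append_right _ _ _ _ (by rw [hE e he]; omega), hE e he, Nat.add_sub_cancel_left,
        hft j hj]

/-! ### Removing repeated rows and columns -/

section Representatives

variable {α : Type} {eq : α → α → Bool}

theorem representatives_concat (l : List α) (x : α) : representatives eq (l ++ [x]) =
    bif (representatives eq l).any (eq x) then representatives eq l
      else x :: representatives eq l := by
  simp [representatives]

theorem mem_of_mem_representatives {l : List α} {x : α} (h : x ∈ representatives eq l) : x ∈ l := by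
  induction l using List.reverseRecOn with
  | nil => simp [representatives] at h
  | append_singleton l y ih =>
    rw [representatives_concat] at h
    cases hy : (representatives eq l).any (eq y) <;> simp only [hy, cond_true, cond_false] at h
    · rcases List.mem_cons.1 h with rfl | h
      · simp
      · simp [ih h]
    · simp [ih h]

/-- Reflexivity suffices: an element is dropped only when directly matched to a kept one, and kept
elements are never discarded. -/
theorem exists_mem_representatives (hrefl : ∀ x, eq x x = true) {l : List α} {x : α} (h : x ∈ l) :
    ∃ y ∈ representatives eq l, eq x y = true := by
  induction l using List.reverseRecOn with
  | nil => simp at h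
  | append_singleton l z ih =>
    rw [representatives_concat]
    cases hz : (representatives eq l).any (eq z) <;> simp only [cond_true, cond_false]
    · rcases List.mem_append.1 h with h | h
      · obtain ⟨y, hy, hxy⟩ := ih h
        exact ⟨y, by simp [hy], hxy⟩
      · rw [List.mem_singleton.1 h]
        exact ⟨z, by simp, hrefl z⟩
    · rcases List.mem_append.1 h with h | h
      · exact ih h
      · rw [List.mem_singleton.1 h]
        simpa using hz

theorem pairwise_representatives (l : List α) :
    (representatives eq l).Pairwise fun x y => eq x y = false := by
  induction l using List.reverseRecOn with
  | nil => simp [representatives]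
  | append_singleton l z ih =>
    rw [representatives_concat]
    cases hz : (representatives eq l).any (eq z) <;> simp only [cond_true, cond_false]
    · refine List.pairwise_cons.2 ⟨fun y hy => ?_, ih⟩
      have := List.any_eq_false.1 hz y hy
      simpa using this
    · exact ih

end Representatives

theorem sameColumn_iff {E : List (List Bool)} {i j : ℕ} :
    sameColumn E i j = true ↔ ∀ r ∈ E, r.getD i false = r.getD j false := by
  simp [sameColumn]

theorem getD_restrictRow {idx : List ℕ} {r : List Bool} {j : ℕ} (hj : j < idx.length) :
    (restrictRow idx r).getD j false = r.getD (idx.getD j 0) false := by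
  simp [restrictRow, hj]

/-! ### The reduced square of a matrix -/

section Reduced

variable {I : ℕ × List (List Bool)}

theorem columns_lt {i : ℕ} (hi : i ∈ columns I) : i < I.1 + I.1 :=
  List.mem_range.1 (mem_of_mem_representatives hi)

theorem not_sameColumn_columns {j k : ℕ} (hj : j < (columns I).length) (hk : k < (columns I).length)
    (h : ∀ r ∈ squareRows I.2, r.getD ((columns I).getD j 0) false =
      r.getD ((columns I).getD k 0) false) : j = k := by
  -- Pairwise distinctness is oriented by the order of the list, so the ordered case comes first and
  -- the other follows by symmetry.
  have key : ∀ j k : ℕ, k < (columns I).length → j < k → ¬ ∀ r ∈ squareRows I.2,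
      r.getD ((columns I).getD j 0) false = r.getD ((columns I).getD k 0) false := by
    intro j k hk hjk h
    have := List.pairwise_iff_getElem.1 (pairwise_representatives
      (eq := sameColumn (squareRows I.2)) (List.range (I.1 + I.1))) j k (hjk.trans hk) hk hjk
    rw [← Bool.not_eq_true, sameColumn_iff] at this
    refine this fun r hr => ?_
    have := h r hr
    rwa [List.getD_eq_getElem _ _ (hjk.trans hk), List.getD_eq_getElem _ _ hk] at this
  rcases lt_trichotomy j k with hjk | hjk | hjk
  · exact absurd h (key j k hk hjk)
  · exact hjk
  · exact absurd (fun r hr => (h r hr).symm) (key k j hj hjk)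

theorem exists_column {i : ℕ} (hi : i < I.1 + I.1) : ∃ j < (columns I).length,
    ∀ r ∈ squareRows I.2, r.getD i false = r.getD ((columns I).getD j 0) false := by
  obtain ⟨k, hk, hik⟩ := exists_mem_representatives (eq := sameColumn (squareRows I.2))
    (fun x => sameColumn_iff.2 fun _ _ => rfl) (List.mem_range.2 hi)
  change k ∈ columns I at hk
  obtain ⟨j, hj, rfl⟩ := List.getElem_of_mem hk
  refine ⟨j, hj, ?_⟩
  rw [List.getD_eq_getElem _ _ hj]
  exact sameColumn_iff.1 hik

theorem mem_reduced {q : List Bool} :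
    q ∈ (reduced I).2 ↔ ∃ r ∈ squareRows I.2, restrictRow (columns I) r = q := by
  rw [← List.mem_map]
  refine ⟨mem_of_mem_representatives, fun h => ?_⟩
  obtain ⟨y, hy, hqy⟩ := exists_mem_representatives (eq := fun r q : List Bool => r == q)
    (fun x => by simp) h
  rwa [show q = y by simpa using hqy]

theorem length_of_mem_reduced {q : List Bool} (hq : q ∈ (reduced I).2) :
    q.length = (reduced I).1 := by
  obtain ⟨r, -, rfl⟩ := mem_reduced.1 hq
  simp [restrictRow, reduced]

theorem MShatters.of_reduced {S' S : Finset ℕ} (h : MShatters (reduced I).2 S')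
    (hS : ∀ i ∈ S, ∃ j ∈ S', j < (columns I).length ∧ (columns I).getD j 0 = i) :
    MShatters (squareRows I.2) S := by
  intro t
  obtain ⟨q, hq, hqt⟩ := h fun j => t ((columns I).getD j 0)
  obtain ⟨r, hr, rfl⟩ := mem_reduced.1 hq
  refine ⟨r, hr, fun i hi => ?_⟩
  obtain ⟨j, hj, hjl, rfl⟩ := hS i hi
  rw [← hqt j hj, getD_restrictRow hjl]

theorem MShatters.exists_reduced {D : Finset ℕ} (hD : ∀ i ∈ D, i < I.1 + I.1)
    (h : MShatters (squareRows I.2) D) : ∃ S : Finset (Fin (reduced I).1), #S = #D ∧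
      MShatters (reduced I).2 (S.map Fin.valEmbedding) := by
  choose! ρ hρ hρ' using fun i (hi : i < I.1 + I.1) => exists_column hi
  have inj : Set.InjOn ρ D := by
    intro i hi k hk hik
    -- The pattern that is true only at `i` separates `i` from any other column of the shattered
    -- set, so columns with a common representative coincide.
    obtain ⟨r, hr, hrt⟩ := h fun j => decide (j = i)
    have h₁ := hrt i hi
    have h₂ := hrt k hk
    rw [hρ' i (hD i hi) r hr, hik, ← hρ' k (hD k hk) r hr, h₂] at h₁
    simpa [eq_comm] using h₁
  have hlt : ∀ j ∈ D.image ρ, j < (reduced I).1 := by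
    intro j hj
    obtain ⟨i, hi, rfl⟩ := mem_image.1 hj
    exact hρ i (hD i hi)
  refine ⟨(D.image ρ).attachFin hlt, by rw [card_attachFin, card_image_of_injOn inj], ?_⟩
  intro t
  obtain ⟨r, hr, hrt⟩ := h fun i => t (ρ i)
  refine ⟨_, mem_reduced.2 ⟨r, hr, rfl⟩, fun j hj => ?_⟩
  obtain ⟨i, hi, rfl⟩ : ∃ i ∈ D, ρ i = j := by simpa using hj
  rw [getD_restrictRow (hρ i (hD i hi)), ← hρ' i (hD i hi) r hr, hrt i hi]

end Reduced

/-! ### Correctness of the compression step -/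

theorem bitSet_clearBit (i : Fin m) (r : List Bool) :
    bitSet m (clearBit i r) = (bitSet m r).erase i := by
  ext j
  rw [mem_bitSet, getD_clearBit, mem_erase, mem_bitSet]
  simp [Fin.ext_iff]

theorem bitSet_meet (C : Finset (Fin m)) {r : List Bool} (hr : r.length = m) :
    bitSet m (meet r (bits C)) = bitSet m r ∩ C := by
  ext j
  have : (meet r (bits C)).getD j false = (r.getD j false && (bits C).getD j false) := by
    simp [meet, hr]
  rw [mem_bitSet, this, getD_bits, mem_inter, mem_bitSet]
  simp

theorem length_of_mem_compressRows {i : ℕ} {F : List (List Bool)} (hF : ∀ r ∈ F, r.length = m) :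
    ∀ r ∈ compressRows i F, r.length = m := by
  intro r hr
  obtain ⟨q, hq, rfl⟩ := List.mem_map.1 hr
  cases F.any (fun p => p == clearBit i q)
  · rw [cond_false, length_clearBit, hF q hq]
  · rw [cond_true, hF q hq]

theorem toFinset_compressRows (i : Fin m) {F : List (List Bool)} (hF : ∀ r ∈ F, r.length = m) :
    ((compressRows i F).map (bitSet m)).toFinset = 𝓓 i (F.map (bitSet m)).toFinset := by
  have hmem {r : List Bool} (hr : r.length = m) :
      bitSet m r ∈ (F.map (bitSet m)).toFinset ↔ r ∈ F := by
    simp only [List.mem_toFinset, List.mem_map]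
    refine ⟨?_, fun h => ⟨r, h, rfl⟩⟩
    rintro ⟨q, hq, hqr⟩
    rwa [← bitSet_injective (hF q hq) hr hqr]
  have hany (r : List Bool) : F.any (fun p => p == clearBit i r) = true ↔ clearBit i r ∈ F := by
    simp
  ext s
  have hs : s ∈ ((compressRows i F).map (bitSet m)).toFinset ↔ ∃ r ∈ F,
      bitSet m (bif F.any (fun p => p == clearBit i r) then r else clearBit i r) = s := by
    simp [compressRows]
  rw [hs, Down.mem_compression]
  constructor
  · rintro ⟨r, hr, rfl⟩
    by_cases h : clearBit i r ∈ F
    · rw [(hany r).2 h, cond_true]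
      left
      rw [hmem (hF r hr), ← bitSet_clearBit, hmem (by rw [length_clearBit, hF r hr])]
      exact ⟨hr, h⟩
    · rw [Bool.eq_false_iff.2 (mt (hany r).1 h), cond_false]
      right
      rw [hmem (by rw [length_clearBit, hF r hr]), bitSet_clearBit]
      refine ⟨h, ?_⟩
      -- Otherwise clearing bit `i` would leave `r` unchanged, and the cleared row would already be
      -- in `F`.
      have hi : i ∈ bitSet m r := by
        by_contra hi
        rw [← erase_eq_self, ← bitSet_clearBit] at hi
        rw [bitSet_injective (by rw [length_clearBit, hF r hr]) (hF r hr) hi] at h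
        exact h hr
      rw [insert_erase hi, hmem (hF r hr)]
      exact hr
  · rintro (⟨h₁, h₂⟩ | ⟨h₁, h₂⟩)
    · obtain ⟨r, hr, rfl⟩ := List.mem_map.1 (List.mem_toFinset.1 h₁)
      rw [← bitSet_clearBit, hmem (by rw [length_clearBit, hF r hr])] at h₂
      exact ⟨r, hr, by rw [(hany r).2 h₂, cond_true]⟩
    · obtain ⟨r, hr, hrs⟩ := List.mem_map.1 (List.mem_toFinset.1 h₂)
      have hi : i ∉ s := fun hi => h₁ (by rwa [insert_eq_of_mem hi] at h₂)
      have hs : bitSet m (clearBit i r) = s := by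
        rw [bitSet_clearBit, hrs, erase_insert hi]
      have h : clearBit i r ∉ F := by
        rwa [← hmem (by rw [length_clearBit, hF r hr]), hs]
      refine ⟨r, hr, ?_⟩
      rw [Bool.eq_false_iff.2 (mt (hany r).1 h), cond_false, hs]

theorem toFinset_compressAll {F : List (List Bool)} (hF : ∀ r ∈ F, r.length = m) :
    ((compressAll m F).map (bitSet m)).toFinset =
      iterCompress (List.finRange m) (F.map (bitSet m)).toFinset := by
  rw [compressAll, ← List.map_coe_finRange_eq_range, iterCompress]
  generalize List.finRange m = l
  induction l generalizing F with
  | nil => rfl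
  | cons i l ih =>
    rw [List.map_cons, List.foldl_cons, List.foldl_cons, ih (length_of_mem_compressRows hF),
      toFinset_compressRows i hF]

/-! ### Lifting sets of columns -/

theorem length_liftRow (idx : List ℕ) (n off : ℕ) (g : List Bool) :
    (liftRow idx n off g).length = n := by
  simp [liftRow]

theorem mem_bitSet_liftRow {idx : List ℕ} {n off : ℕ} {g : List Bool} {i : Fin n} :
    i ∈ bitSet n (liftRow idx n off g) ↔
      ∃ j < idx.length, idx.getD j 0 = off + i ∧ g.getD j false = true := by
  have : (liftRow idx n off g).getD i false = (List.range idx.length).any fun j =>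
      idx.getD j 0 == off + i && g.getD j false := by
    simp [liftRow]
  rw [mem_bitSet, this]
  simp [-List.getD_eq_getElem?_getD]

/-! ### Correctness of the reduction -/

/-- The incidence matrix of a hypergraph. -/
def Hypergraph.matrix (H : Hypergraph) : ℕ × List (List Bool) := (H.n, H.edges.map bits)

theorem encList_map {α β : Type} (f : α → β) (enc : β → Data) (l : List α) :
    encList enc (l.map f) = encList (fun a => enc (f a)) l := by
  induction l with
  | nil => rfl
  | cons a l ih => simp [encList, ih]

theorem enc_bits {m : ℕ} (C : Finset (Fin m)) : Enc.enc (bits C) = encSet C := rfl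

theorem enc_matrix (H : Hypergraph) : Enc.enc H.matrix = H.encode := by
  change Data.cons (encNat H.n) (encList Enc.enc (H.edges.map bits)) = _
  rw [encList_map]
  rfl

theorem length_of_mem_matrix {H : Hypergraph} {r : List Bool} (hr : r ∈ H.matrix.2) :
    r.length = H.n := by
  obtain ⟨e, -, rfl⟩ := List.mem_map.1 hr
  exact length_bits e

theorem shattered_iff_mShatters {H : Hypergraph} {Y : Finset (Fin H.n)} :
    H.Shattered Y ↔ MShatters H.matrix.2 (Y.map Fin.valEmbedding) := by
  rw [← shatters_iff_mShatters, Hypergraph.Shattered, Hypergraph.matrix, List.map_map]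
  simp [Function.comp_def, bitSet_bits]

/-- The square of a hypergraph with twins removed. -/
def Hypergraph.reducedSquare (H : Hypergraph) : Hypergraph where
  n := (reduced H.matrix).1
  edges := (reduced H.matrix).2.map (bitSet _)
  edges_ne_nil := by
    obtain ⟨e, he⟩ := List.exists_mem_of_ne_nil _ H.edges_ne_nil
    have he : bits e ∈ H.matrix.2 := List.mem_map_of_mem he
    have := mem_reduced.2 ⟨_, mem_squareRows.2 ⟨_, he, _, he, rfl⟩, rfl⟩
    exact List.ne_nil_of_mem (List.mem_map_of_mem this)

theorem edges_reducedSquare (H : Hypergraph) :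
    H.reducedSquare.edges = (reduced H.matrix).2.map (bitSet H.reducedSquare.n) := rfl

/-- Identifies the output of the preprocessing program as the encoding of a hypergraph, hence as a
legal input for the given algorithm. -/
theorem matrix_reducedSquare (H : Hypergraph) : H.reducedSquare.matrix = reduced H.matrix := by
  refine Prod.ext rfl ?_
  change ((reduced H.matrix).2.map (bitSet _)).map bits = _
  rw [List.map_map]
  conv_rhs => rw [← List.map_id (reduced H.matrix).2]
  exact List.map_congr_left fun r hr => bits_bitSet (length_of_mem_reduced hr)

theorem enc_reduced (H : Hypergraph) :
    Enc.enc (reduced H.matrix) = H.reducedSquare.encode := by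
  rw [← enc_matrix, matrix_reducedSquare]

theorem twinFree_reducedSquare (H : Hypergraph) : H.reducedSquare.TwinFree := by
  constructor
  · refine List.Nodup.map_on (fun r hr q hq h => ?_) ?_
    · exact bitSet_injective (length_of_mem_reduced hr) (length_of_mem_reduced hq) h
    · refine (pairwise_representatives _).imp fun {r q} h => ?_
      simpa using h
  · intro x y h
    refine Fin.ext (not_sameColumn_columns x.2 y.2 fun r hr => ?_)
    have := h _ (List.mem_map_of_mem (mem_reduced.2 ⟨r, hr, rfl⟩))
    change x ∈ bitSet H.reducedSquare.n _ ↔ y ∈ bitSet H.reducedSquare.n _ at this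
    rw [mem_bitSet, mem_bitSet, getD_restrictRow x.2, getD_restrictRow y.2] at this
    rwa [Bool.eq_iff_iff]

/-! ### From many classes to large shattered sets -/

theorem pow_card_le_numClasses {H : Hypergraph} {D : Finset (Fin H.n)} (h : H.Shattered D) :
    2 ^ #D ≤ H.numClasses D := by
  rw [← card_powerset]
  refine card_le_card fun t ht => ?_
  obtain ⟨u, hu, rfl⟩ := h (mem_powerset.1 ht)
  simp only [List.mem_toFinset, List.mem_map] at hu ⊢
  exact ⟨u, hu, inter_comm _ _⟩

theorem exists_shattered_card_eq_vcDim (H : Hypergraph) :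
    ∃ D : Finset (Fin H.n), H.Shattered D ∧ #D = H.vcDim := by
  have hne : H.edges.toFinset.shatterer.Nonempty := by
    refine ⟨∅, mem_shatterer.2 ?_⟩
    rw [shatters_empty]
    simpa using H.edges_ne_nil
  obtain ⟨D, hD, h⟩ := exists_mem_eq_sup _ hne card
  exact ⟨D, mem_shatterer.1 hD, h.symm⟩

theorem exists_shattered_reducedSquare (H : Hypergraph) :
    ∃ D : Finset (Fin H.reducedSquare.n), H.reducedSquare.Shattered D ∧ #D = 2 * H.vcDim := by
  obtain ⟨D, hD, hDc⟩ := exists_shattered_card_eq_vcDim H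
  obtain ⟨S, hS, hSn, hSs⟩ := (shattered_iff_mShatters.1 hD).exists_squareRows (n := H.n)
    (fun e he => length_of_mem_matrix he) (fun i hi => by
      obtain ⟨j, -, rfl⟩ := mem_map.1 hi
      exact j.2)
  obtain ⟨S', hS', hSs'⟩ := hSs.exists_reduced (I := H.matrix) hSn
  refine ⟨S', shattered_iff_mShatters.2 ?_, ?_⟩
  · rw [matrix_reducedSquare]
    exact hSs'
  · exact hS'.trans (by rw [hS, card_map, hDc])

/-- The down-set obtained from the traces of the hyperedges of the reduced square on `C`. -/
theorem toFinset_compressAll_meet (H : Hypergraph) (C : Finset (Fin H.reducedSquare.n)) :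
    ((compressAll (reduced H.matrix).1 ((reduced H.matrix).2.map fun r => meet r (bits C))).map
      (bitSet H.reducedSquare.n)).toFinset = iterCompress (List.finRange H.reducedSquare.n)
        (H.reducedSquare.edges.map fun e => e ∩ C).toFinset := by
  refine (toFinset_compressAll (m := H.reducedSquare.n) fun r hr => ?_).trans ?_
  · obtain ⟨q, hq, rfl⟩ := List.mem_map.1 hr
    have : (meet q (bits C)).length = q.length := by simp [meet]
    exact this.trans (length_of_mem_reduced hq)
  · congr 2
    rw [edges_reducedSquare, List.map_map, List.map_map]
    exact List.map_congr_left fun r hr => bitSet_meet C (length_of_mem_reduced hr)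

/-- Compression gives a set shattered by the traces on `C`. Such a set lies inside `C`, where a
hyperedge and its trace agree, so the hyperedges shatter it too. -/
theorem shattered_of_mem_compressAll {H : Hypergraph} {C : Finset (Fin H.reducedSquare.n)}
    {g : List Bool} (hg : g ∈ compressAll (reduced H.matrix).1
      ((reduced H.matrix).2.map fun r => meet r (bits C))) :
    H.reducedSquare.Shattered (bitSet _ g) := by
  have hmem : bitSet H.reducedSquare.n g ∈ iterCompress (List.finRange H.reducedSquare.n)
      (H.reducedSquare.edges.map fun e => e ∩ C).toFinset := by
    rw [← toFinset_compressAll_meet]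
    simpa using ⟨g, hg, rfl⟩
  have h := shatters_of_mem_iterCompress List.mem_finRange hmem
  obtain ⟨u, hu, hgu⟩ := h.exists_superset
  have hC : bitSet H.reducedSquare.n g ⊆ C := by
    simp only [List.mem_toFinset, List.mem_map] at hu
    obtain ⟨e, -, rfl⟩ := hu
    exact hgu.trans inter_subset_right
  intro t ht
  obtain ⟨u, hu, rfl⟩ := h ht
  simp only [List.mem_toFinset, List.mem_map] at hu
  obtain ⟨e, he, rfl⟩ := hu
  refine ⟨e, by simpa using he, ?_⟩
  rw [inter_comm e, ← inter_assoc, inter_eq_left.2 hC]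

theorem exists_eq_bits_of_mem_candidates {H : Hypergraph} {C : Finset (Fin H.reducedSquare.n)}
    {y : List Bool} (hy : y ∈ candidates H.matrix (bits C)) :
    ∃ Y : Finset (Fin H.n), y = bits Y ∧ H.Shattered Y := by
  obtain ⟨g, hg, hy⟩ := List.mem_flatMap.1 hy
  have hs := shattered_iff_mShatters.1 (shattered_of_mem_compressAll hg)
  rw [matrix_reducedSquare] at hs
  have hsq : MShatters (squareRows H.matrix.2) (((bitSet H.reducedSquare.n g).map
      Fin.valEmbedding).image fun j => (columns H.matrix).getD j 0) := by
    refine hs.of_reduced fun i hi => ?_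
    obtain ⟨j, hj, rfl⟩ := mem_image.1 hi
    refine ⟨j, hj, ?_, rfl⟩
    obtain ⟨k, -, rfl⟩ := mem_map.1 hj
    exact k.2
  have hmem (off : ℕ) (i : Fin H.n)
      (hi : i ∈ bitSet H.n (liftRow (columns H.matrix) H.n off g)) :
      off + i ∈ (((bitSet H.reducedSquare.n g).map
        Fin.valEmbedding).image fun j => (columns H.matrix).getD j 0) := by
    obtain ⟨j, hj, hji, hgj⟩ := mem_bitSet_liftRow.1 hi
    exact mem_image.2 ⟨j, mem_map.2 ⟨⟨j, hj⟩, mem_bitSet.2 hgj, rfl⟩, hji⟩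
  have hlen : ∀ e ∈ H.matrix.2, e.length = H.n := fun e he => length_of_mem_matrix he
  rcases List.mem_cons.1 hy with rfl | hy
  · refine ⟨bitSet H.n _, (bits_bitSet (length_liftRow _ _ _ _)).symm, ?_⟩
    refine shattered_iff_mShatters.2 (hsq.of_squareRows_left hlen fun i hi => ?_)
    obtain ⟨k, hk, rfl⟩ := mem_map.1 hi
    have := hmem 0 k hk
    rw [zero_add] at this
    exact ⟨k.2, this⟩
  · obtain rfl := List.mem_singleton.1 hy
    refine ⟨bitSet H.n _, (bits_bitSet (length_liftRow _ _ _ _)).symm, ?_⟩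
    refine shattered_iff_mShatters.2 (hsq.of_squareRows_right hlen fun i hi => ?_)
    obtain ⟨k, hk, rfl⟩ := mem_map.1 hi
    exact hmem H.n k hk

/-- Distinct columns of the reduced square come from distinct columns of the square, and each of
these lies in the first or the second copy; no vertex is lost in lifting. -/
theorem card_bitSet_le_liftRow (H : Hypergraph) (g : List Bool) :
    #(bitSet H.reducedSquare.n g) ≤ weight (liftRow (columns H.matrix) H.n 0 g) +
      weight (liftRow (columns H.matrix) H.n H.n g) := by
  rw [← card_bitSet (length_liftRow _ H.n 0 g), ← card_bitSet (length_liftRow _ H.n H.n g)]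
  let f : Fin H.reducedSquare.n → ℕ := fun j => (columns H.matrix).getD j 0
  have hf : Function.Injective f := fun j k h =>
    Fin.ext (not_sameColumn_columns j.2 k.2 fun r _ => congrArg (fun i => r.getD i false) h)
  rw [← card_map (addLeftEmbedding H.n |> Fin.valEmbedding.trans)
    (s := bitSet H.n (liftRow (columns H.matrix) H.n H.n g)),
    ← card_map Fin.valEmbedding (s := bitSet H.n (liftRow (columns H.matrix) H.n 0 g)),
    ← card_image_of_injective _ hf]
  refine (card_le_card fun i hi => ?_).trans (card_union_le _ _)
  obtain ⟨j, hj, rfl⟩ := mem_image.1 hi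
  have hlt : f j < H.n + H.n := by
    have : f j ∈ columns H.matrix := by
      change (columns H.matrix).getD j 0 ∈ _
      rw [List.getD_eq_getElem _ _ j.2]
      exact List.getElem_mem _
    exact columns_lt this
  rw [mem_union]
  rcases lt_or_ge (f j) H.n with h | h
  · exact .inl (mem_map.2 ⟨⟨f j, h⟩, mem_bitSet_liftRow.2
      ⟨j, j.2, (zero_add (f j)).symm, mem_bitSet.1 hj⟩, rfl⟩)
  · refine .inr (mem_map.2 ⟨⟨f j - H.n, by omega⟩, mem_bitSet_liftRow.2
      ⟨j, j.2, ?_, mem_bitSet.1 hj⟩, ?_⟩)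
    · exact (Nat.add_sub_cancel' h).symm
    · exact Nat.add_sub_cancel' h

theorem exists_mem_candidates {H : Hypergraph} {C : Finset (Fin H.reducedSquare.n)}
    (hC : #C = 2 * H.vcDim) (h : ∀ D : Finset (Fin H.reducedSquare.n), #D = 2 * H.vcDim →
      H.reducedSquare.numClasses D ≤ 2 * H.reducedSquare.numClasses C) :
    ∃ y ∈ candidates H.matrix (bits C), H.vcDim ≤ 2 * weight y := by
  obtain ⟨D, hD, hDc⟩ := exists_shattered_reducedSquare H
  obtain ⟨s, hs, hsc⟩ := exists_mem_iterCompress_card_ge List.mem_finRange hC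
    (𝒜 := (H.reducedSquare.edges.map fun e => e ∩ C).toFinset) (fun s hs => by
      simp only [List.mem_toFinset, List.mem_map] at hs
      obtain ⟨e, -, rfl⟩ := hs
      exact inter_subset_right)
    -- The shattered `D` of size 2d induces 2^(2d) classes, so the approximation guarantee leaves at
    -- least half as many for `C`.
    (by rw [hC, ← hDc]; exact (pow_card_le_numClasses hD).trans (h D hDc))
  rw [← toFinset_compressAll_meet] at hs
  obtain ⟨g, hg, rfl⟩ := List.mem_map.1 (List.mem_toFinset.1 hs)
  have := card_bitSet_le_liftRow H g
  rcases le_total (weight (liftRow (columns H.matrix) H.n 0 g))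
    (weight (liftRow (columns H.matrix) H.n H.n g)) with hle | hle
  · exact ⟨_, List.mem_flatMap.2 ⟨g, hg, .tail _ (.head _)⟩, by
      change _ ≤ 2 * weight (liftRow (columns H.matrix) H.n H.n g); omega⟩
  · exact ⟨_, List.mem_flatMap.2 ⟨g, hg, .head _⟩, by
      change _ ≤ 2 * weight (liftRow (columns H.matrix) H.n 0 g); omega⟩

theorem foldl_better (l : List (List Bool)) (b : List Bool) :
    (l.foldl better b = b ∨ l.foldl better b ∈ l) ∧ weight b ≤ weight (l.foldl better b) ∧
      ∀ y ∈ l, weight y ≤ weight (l.foldl better b) := by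
  induction l generalizing b with
  | nil => simp
  | cons a l ih =>
    obtain ⟨h₁, h₂, h₃⟩ := ih (better b a)
    have hb : (better b a = b ∨ better b a = a) ∧ weight b ≤ weight (better b a) ∧
        weight a ≤ weight (better b a) := by
      by_cases h : weight b < weight a
      · simp [better, h, h.le]
      · simp [better, h, not_lt.1 h]
    rw [List.foldl_cons]
    refine ⟨?_, hb.2.1.trans h₂, fun y hy => ?_⟩
    · rcases h₁ with h₁ | h₁
      · rw [h₁]
        rcases hb.1 with h | h <;> simp [h]
      · exact .inr (.tail _ h₁)
    · rcases List.mem_cons.1 hy with rfl | hy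
      · exact hb.2.2.trans h₂
      · exact h₃ y hy

/-- Every round preserves shattering and never loses size; only the round with `#C = 2 * H.vcDim`
has to gain, and the program need not know which one that is. -/
theorem improve_bits {H : Hypergraph} (C : Finset (Fin H.reducedSquare.n)) {Y : Finset (Fin H.n)}
    (hY : H.Shattered Y) : ∃ Y' : Finset (Fin H.n), improve H.matrix (bits C) (bits Y) = bits Y' ∧
      H.Shattered Y' ∧ #Y ≤ #Y' ∧ (#C = 2 * H.vcDim →
        (∀ D : Finset (Fin H.reducedSquare.n), #D = 2 * H.vcDim →
          H.reducedSquare.numClasses D ≤ 2 * H.reducedSquare.numClasses C) →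
        H.vcDim ≤ 2 * #Y') := by
  obtain ⟨h₁, h₂, h₃⟩ := foldl_better (candidates H.matrix (bits C)) (bits Y)
  obtain ⟨Y', hY', hs⟩ : ∃ Y' : Finset (Fin H.n),
      improve H.matrix (bits C) (bits Y) = bits Y' ∧ H.Shattered Y' := by
    rcases h₁ with h₁ | h₁
    · exact ⟨Y, h₁, hY⟩
    · exact exists_eq_bits_of_mem_candidates h₁
  change improve H.matrix (bits C) (bits Y) = _ ∨ _ at h₁
  change _ ≤ weight (improve H.matrix (bits C) (bits Y)) at h₂
  change ∀ y ∈ _, _ ≤ weight (improve H.matrix (bits C) (bits Y)) at h₃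
  rw [hY', card_eq_weight_bits] at h₂ h₃
  refine ⟨Y', hY', hs, by rwa [card_eq_weight_bits] at h₂, fun hC h => ?_⟩
  obtain ⟨y, hy, hyc⟩ := exists_mem_candidates hC h
  have := h₃ y hy
  omega

/-! ### The main program -/

/-- One round of the main loop: the matrix is in variable `0`, the reduced square in variable `1`,
the list of cardinalities still to be tried in variable `2`, the best set found so far in `3`. -/
def mainBody (A post : Cmd) : Cmd :=
  .seq (.head 4 2) (.seq (.tail 2 2) (.seq (.cons 4 4 1) (.seq (.call 4 A 4)
    (.seq (.cons 4 4 3) (.seq (.cons 4 0 4) (.call 3 post 4))))))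

/-- The main program: try all cardinalities in turn. -/
def mainProgram (A pre sizes start post : Cmd) : Cmd :=
  .seq (.call 1 pre 0) (.seq (.call 2 sizes 0) (.seq (.call 3 start 0)
    (.seq (.while 2 (mainBody A post)) (.copy 0 3))))

theorem esize_bits_le {m : ℕ} (C : Finset (Fin m)) : esize (bits C) ≤ 4 * m + 1 := by
  have key (l : List Bool) : esize l ≤ 4 * l.length + 1 := by
    induction l with
    | nil => exact le_rfl
    | cons b l ih =>
      have := PolyTime.esize_bool_le b
      rw [esize_cons, List.length_cons]
      omega
  simpa [length_bits] using key (bits C)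

/-- Only `A` may consume coins, and its guarantee holds for each coin sequence, in particular for
the tosses left by earlier rounds. The 8 is the overhead of seven in `mainBody` plus the loop test.
-/
theorem exec_mainLoop {A post : Cmd} {T : ℕ → ℕ} (hA : IsTwoApproxMaxPartialVC A T)
    {Tp : (ℕ × List (List Bool)) × List Bool × List Bool → ℕ}
    (hpost : ∀ p ω, ∃ s t, Exec post (initStore (Enc.enc p)) ω s ω t ∧
      s 0 = Enc.enc (improve p.1 p.2.1 p.2.2) ∧ t ≤ Tp p)
    (H : Hypergraph) (N B : ℕ)
    (hN : ∀ k ≤ H.reducedSquare.n, T (encInstance H.reducedSquare k).size ≤ N)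
    (hB : ∀ (C : Finset (Fin H.reducedSquare.n)) (Y : Finset (Fin H.n)),
      Tp (H.matrix, bits C, bits Y) ≤ B)
    (ks : List ℕ) (hks : ∀ k ∈ ks, k ≤ H.reducedSquare.n) (Y : Finset (Fin H.n))
    (hY : H.Shattered Y) (s : Store) (ω : Coins) (h0 : s 0 = Enc.enc H.matrix)
    (h1 : s 1 = H.reducedSquare.encode) (h2 : s 2 = Enc.enc ks) (h3 : s 3 = encSet Y) :
    ∃ (s' : Store) (ω' : Coins) (t : ℕ) (Y' : Finset (Fin H.n)),
      Exec (.while 2 (mainBody A post)) s ω s' ω' t ∧ s' 3 = encSet Y' ∧ H.Shattered Y' ∧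
      Y.card ≤ Y'.card ∧ (2 * H.vcDim ∈ ks → H.vcDim ≤ 2 * Y'.card) ∧
      t ≤ ks.length * (N + B + 8) + 1 := by
  induction ks generalizing Y s ω with
  | nil =>
    exact ⟨s, ω, 1, Y, .whileDone (by simp [h2, Enc.enc, encList]), h3, hY, le_rfl, by simp,
      by simp⟩
  | cons k ks ih =>
    have hk : k ≤ H.reducedSquare.n := hks k (by simp)
    obtain ⟨C, tA, ⟨sA, ωA, eA, hsA⟩, htA, hCk, hCopt⟩ :=
      hA H.reducedSquare k (twinFree_reducedSquare H) hk ω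
    obtain ⟨sp, tp, ep, hsp, htp⟩ := hpost (H.matrix, bits C, bits Y) ωA
    obtain ⟨Y₁, himp, hY₁, hle₁, hgood₁⟩ := improve_bits C hY
    obtain ⟨u, hu, hu0, hu1, hu2, hu3⟩ : ∃ u, Exec (mainBody A post) s ω u ωA
        (1 + (1 + (1 + ((tA + 1) + (1 + (1 + (tp + 1))))))) ∧ u 0 = Enc.enc H.matrix ∧
        u 1 = H.reducedSquare.encode ∧ u 2 = Enc.enc ks ∧ u 3 = encSet Y₁ := by
      refine ⟨_, .seq (.head 4 2 s ω) (.seq (.tail 2 2 _ ω) (.seq (.cons 4 4 1 _ ω)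
        (.seq (exec_call ?_ eA) (.seq (.cons 4 4 3 _ ωA) (.seq (.cons 4 0 4 _ ωA)
          (exec_call ?_ ep)))))), ?_, ?_, ?_, ?_⟩
      · simp [h1, h2, Enc.enc, encList, encInstance, Data.fst]
      · simp [h0, h3, hsA, Enc.enc, ← enc_bits]
      · simp [h0]
      · simp [h1]
      · simp [h2, Enc.enc, encList, Data.snd]
      · simp [hsp, himp, enc_bits]
    obtain ⟨s', ω', t, Y', e, hs', hY', hle, hgood, ht⟩ :=
      ih (fun j hj => hks j (by simp [hj])) Y₁ hY₁ u ωA hu0 hu1 hu2 hu3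
    refine ⟨s', ω', _, Y', .whileStep (by simp [h2, Enc.enc, encList]) hu e, hs', hY',
      hle₁.trans hle, fun hmem => ?_, ?_⟩
    · rcases List.mem_cons.1 hmem with h | h
      · have := hgood₁ (by rw [hCk, h]) (by rw [h]; exact hCopt)
        omega
      · exact hgood h
    · have h₁ := hN k hk
      have h₂ := hB C Y
      rw [List.length_cons, Nat.add_mul]
      omega

theorem shattered_empty (H : Hypergraph) : H.Shattered ∅ := by
  rw [Hypergraph.Shattered, Finset.shatters_empty]
  simpa using H.edges_ne_nil

/-- The auxiliary programs do not depend on `A`, which is why one polynomial serves all algorithms.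
-/
theorem exists_vcDim_program : ∃ p : ℕ[X], ∀ (A : Cmd) (T : ℕ → ℕ), Monotone T →
    IsTwoApproxMaxPartialVC A T → ∃ B : Cmd, ∀ (H : Hypergraph) (ω : Coins),
      ∃ (Y : Finset (Fin H.n)) (t : ℕ), Outputs B H.encode ω (encSet Y) t ∧
        t ≤ p.eval H.encode.size * (T (p.eval H.encode.size) + 1) ∧ H.Shattered Y ∧
        H.vcDim ≤ 2 * Y.card := by
  obtain ⟨⟨p₁, hp₁⟩, pre, T₁, ⟨q₁, hq₁⟩, hpre⟩ := PolyTime.reduced (PolyTime.id')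
  obtain ⟨⟨p₂, hp₂⟩, sizes, T₂, ⟨q₂, hq₂⟩, hsizes⟩ : PolyTime fun I : ℕ × List (List Bool) =>
    List.range ((columns I).length + 1) := by fun_prop
  obtain ⟨-, start, T₃, ⟨q₃, hq₃⟩, hstart⟩ : PolyTime fun I : ℕ × List (List Bool) =>
    (List.range I.1).map fun _ => false := by fun_prop
  obtain ⟨-, post, T₄, ⟨q₄, hq₄⟩, hpost⟩ : PolyTime
    fun p : (ℕ × List (List Bool)) × List Bool × List Bool => improve p.1 p.2.1 p.2.2 :=
      PolyTime.improve (by fun_prop) (by fun_prop) (by fun_prop)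
  dsimp only at hp₁ hp₂
  -- `S` bounds the size of every instance passed to `A`, and `B` the time of one run of `post`,
  -- whose two bit vectors have sizes at most `4 * p₁ + 1` and `4 * X + 1`.
  let S : ℕ[X] := p₁ + p₁ + 1
  let B : ℕ[X] := q₄.comp (X + (4 * p₁ + 1 + (4 * X + 1) + 1) + 1)
  -- The summand `S` lets monotonicity of `T` absorb the instance size; 5 is the overhead outside
  -- the rounds, and `B + 9` works because T + B + 8 ≤ (B + 9)(T + 1).
  refine ⟨S + (q₁ + q₂ + q₃ + 5 + p₂ * (B + 9)), fun A T hT hA =>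
    ⟨mainProgram A pre sizes start post, fun H ω => ?_⟩⟩
  set N := H.encode.size
  have hN : esize H.matrix = N := by rw [esize, enc_matrix]
  have hred : 2 * H.reducedSquare.n + 1 ≤ p₁.eval N := by
    have h := hp₁ H.matrix
    rw [hN, ← Prod.mk.eta (p := reduced H.matrix), esize_prod, PolyTime.esize_nat] at h
    change (2 * H.reducedSquare.n + 1) + _ + 1 ≤ _ at h
    omega
  have hHn : H.n ≤ N := by
    rw [← hN, ← Prod.mk.eta (p := H.matrix), esize_prod, PolyTime.esize_nat]
    change H.n ≤ (2 * H.n + 1) + _ + 1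
    omega
  obtain ⟨s₁, t₁, e₁, hs₁, ht₁⟩ := hpre H.matrix ω
  obtain ⟨s₂, t₂, e₂, hs₂, ht₂⟩ := hsizes H.matrix ω
  obtain ⟨s₃, t₃, e₃, hs₃, ht₃⟩ := hstart H.matrix ω
  -- The search starts from the empty set, which is shattered because there is a hyperedge.
  have hstart' : (List.range H.matrix.1).map (fun _ => false) = bits (∅ : Finset (Fin H.n)) := by
    refine bitSet_injective (m := H.n) (by simp [Hypergraph.matrix]) (length_bits _) ?_
    rw [bitSet_bits]
    ext i
    simp [mem_bitSet, Hypergraph.matrix]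
  have hinst (k : ℕ) (hk : k ≤ H.reducedSquare.n) :
      T (encInstance H.reducedSquare k).size ≤ T (S.eval N) := by
    have h : (encInstance H.reducedSquare k).size = (2 * k + 1) + esize (reduced H.matrix) + 1 := by
      rw [← PolyTime.esize_nat, esize, esize, enc_reduced]
      rfl
    have h' := hp₁ H.matrix
    rw [hN] at h'
    have hS : S.eval N = p₁.eval N + p₁.eval N + 1 := by simp [S]
    rw [h, hS]
    exact hT (by omega)
  have hround (C : Finset (Fin H.reducedSquare.n)) (Y : Finset (Fin H.n)) :
      T₄ (H.matrix, bits C, bits Y) ≤ B.eval N := by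
    have hBe : B.eval N = q₄.eval (N + (4 * p₁.eval N + 1 + (4 * N + 1) + 1) + 1) := by simp [B]
    rw [hBe]
    refine (hq₄ _).trans (eval_nat_mono q₄ ?_)
    have h₁ := esize_bits_le C
    have h₂ := esize_bits_le Y
    rw [esize_prod, esize_prod (bits C), hN]
    omega
  obtain ⟨s', ω', t, Y, e, hs', hY, -, hgood, ht⟩ := exec_mainLoop hA hpost H (T (S.eval N))
    (B.eval N) hinst hround (List.range ((columns H.matrix).length + 1))
    (fun k hk => Nat.le_of_lt_succ (List.mem_range.1 hk)) ∅ (shattered_empty H)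
    (Function.update (Function.update (Function.update (initStore H.encode) 1 (s₁ 0)) 2 (s₂ 0)) 3
      (s₃ 0)) ω (by simp [initStore, enc_matrix]) (by simp [hs₁, enc_reduced]) (by simp [hs₂])
      (by simp only [Function.update_self, hs₃, hstart', enc_bits])
  refine ⟨Y, _, ⟨_, ω', .seq (exec_call ?_ e₁) (.seq (exec_call ?_ e₂) (.seq (exec_call ?_ e₃)
    (.seq e (.copy 0 3 _ ω')))), ?_⟩, ?_, hY, hgood ?_⟩
  · simp [initStore, enc_matrix]
  · simp [initStore, enc_matrix]
  · simp [initStore, enc_matrix]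
  · simpa using hs'
  · have h₁ := hq₁ H.matrix
    have h₂ := hq₂ H.matrix
    have h₃ := hq₃ H.matrix
    have h₄ := (PolyTime.length_le_esize _).trans (hp₂ H.matrix)
    rw [hN] at h₁ h₂ h₃ h₄
    set P := (S + (q₁ + q₂ + q₃ + 5 + p₂ * (B + 9))).eval N with hP
    have hPe : P = S.eval N + (q₁.eval N + q₂.eval N + q₃.eval N + 5 +
        p₂.eval N * (B.eval N + 9)) := by
      simp [hP]
    have hTS : T (S.eval N) ≤ T P := hT (by omega)
    have h₅ := ht.trans (Nat.add_le_add_right (Nat.mul_le_mul_right _ h₄) 1)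
    have h₆ : p₂.eval N * (T (S.eval N) + B.eval N + 8) ≤
        p₂.eval N * (B.eval N + 9) * (T P + 1) := by
      rw [mul_assoc]
      refine Nat.mul_le_mul_left _ ?_
      nlinarith [Nat.zero_le (B.eval N * T P)]
    have h₇ : q₁.eval N + q₂.eval N + q₃.eval N + 5 ≤
        (q₁.eval N + q₂.eval N + q₃.eval N + 5) * (T P + 1) :=
      Nat.le_mul_of_pos_right _ (Nat.succ_pos _)
    have h₈ : (q₁.eval N + q₂.eval N + q₃.eval N + 5) * (T P + 1) +
        p₂.eval N * (B.eval N + 9) * (T P + 1) ≤ P * (T P + 1) := by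
      rw [← Nat.add_mul]
      exact Nat.mul_le_mul_right _ (by omega)
    omega
  -- The reduced square contains a set of size 2d, so 2d is among the cardinalities tried.
  · obtain ⟨D, -, hD⟩ := exists_shattered_reducedSquare H
    have := Finset.card_le_univ D
    rw [Fintype.card_fin, hD] at this
    exact List.mem_range.2 (Nat.lt_succ_of_le this)

/-! ### The success probability and the theorem -/

instance : MeasureTheory.IsProbabilityMeasure fairCoins := by
  unfold fairCoins
  infer_instance

end PartialVC

theorem mainTheorem5 :
    ∃ p : Polynomial ℕ, ∀ (A : PartialVC.Cmd) (T : ℕ → ℕ), Monotone T →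
      PartialVC.IsTwoApproxMaxPartialVC A T →
      ∃ B : PartialVC.Cmd,
        PartialVC.IsRandomizedTwoApproxMaxVC B
          (fun N => p.eval N * (T (p.eval N) + 1)) := by
  obtain ⟨p, hp⟩ := PartialVC.exists_vcDim_program
  refine ⟨p, fun A T hT hA => ?_⟩
  obtain ⟨B, hB⟩ := hp A T hT hA
  refine ⟨B, fun H => ⟨fun ω => ?_, ?_⟩⟩
  · obtain ⟨Y, t, h, ht, hY, -⟩ := hB H ω
    exact ⟨Y, t, h, ht, hY⟩
  -- The success event contains every coin sequence, so its probability is 1.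
  · refine (?_ : 2 / 3 ≤ PartialVC.fairCoins Set.univ).trans (MeasureTheory.measure_mono ?_)
    · rw [MeasureTheory.measure_univ]
      exact ENNReal.div_le_of_le_mul (by norm_num)
    · intro ω _
      obtain ⟨Y, t, h, -, hY, hdim⟩ := hB H ω
      exact ⟨Y, t, h, hY, hdim⟩
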